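/- Let $k$ be a commutative ring (for instance a field of characteristic $0$), $R$ a commutative unital $k$-algebra, and $(R,L)$ a Lie--Rinehart pair over $k$: $L$ is a $k$-Lie algebra and an $R$-module, acting on $R$ by $k$-linear derivations $r\mapsto x(r)$ through an $R$-linear morphism of Lie algebras $L\to \mathrm{Der}_k(R)$, with $[x,ry]=r[x,y]+x(r)y$. Let $U=U(R,L)$ be its universal enveloping algebra, i.e. the quotient of the enveloping algebra of the $k$-Lie algebra $R\oplus L$, with $[(r_1,x_1),(r_2,x_2)]=(x_1(r_2)-x_2(r_1),[x_1,x_2])$, by the relations $r'\cdot(r+x)=r'r+r'x$ and $1_R=1$. It acts on $R$ ($R$ by multiplication, $L$ by derivations); it has the counit $\varepsilon_U(u)=u\cdot 1$ and the coproduct $\Delta_U(u)=\sum u_{1}\otimes u_{2}\in U\otimes_R U$ (tensor product of left $R$-modules), $\Delta_U(u)=u\cdot(1\otimes 1)$, where $r\in R$ acts on $U\otimes_RU$ through the left module structure and $x\in L$ by $x\cdot(u\otimes v)=xu\otimes v+u\otimes xv$; thus $\Delta_U(r)=r\otimes 1$ and $\Delta_U(x)=x\otimes 1+1\otimes x$.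 Let $H=\mathrm{Hom}_R(U,R)$ be the set of homomorphisms of left $R$-modules. The completed tensor powers of $H$ over $R$ (right unit on the left factor, left unit on the right factor) are $H\hat\otimes_R H=\mathrm{Hom}_R(U\otimes_R U,R)$ and $H\hat\otimes_R H\hat\otimes_R H=\mathrm{Hom}_R(U\otimes_R U\otimes_R U,R)$, where now the tensor products are those of $R$-bimodules ($ur\otimes v=u\otimes rv$); here $\varphi\otimes\psi$ is the functional $(u,v)\mapsto\varphi(u\,\psi(v))$, and $(FG)(u,v)=\sum F(u_1,v_1)G(u_2,v_2)$. Let $R$ carry a ring topology for which all the derivations $r\mapsto x(r)$, $x\in L$, are continuous (for instance the discrete one), and give these spaces the topology of pointwise convergence. Then the structure maps $$(\varphi\psi)(u)=\sum\varphi(u_1)\psi(u_2),\quad 1_H=\varepsilon_U,\quad \eta_L(r)(u)=r\,\varepsilon_U(u),\quad \eta_R(r)(u)=u\cdot r=\varepsilon_U(ur),\quad \Delta(\varphi)(u,v)=\varphi(uv),\quad \varepsilon(\varphi)=\varphi(1)$$ are well defined and make $(R,H)$ a topological, unital and counital commutative bialgebroid over $k$. That is: $H$ and $H\hat\otimes_RH$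 (with unit $1\otimes1$) are topological commutative associative unital $k$-algebras; $(\varphi,\psi)\mapsto\varphi\otimes\psi$ is continuous, multiplicative and satisfies $\varphi\,\eta_R(r)\otimes\psi=\varphi\otimes\eta_L(r)\,\psi$; $\eta_L$, $\eta_R$, $\varepsilon$ and $\Delta$ are continuous morphisms of unital $k$-algebras; and $$(\mathrm{id}\otimes\varepsilon)\Delta=(\varepsilon\otimes\mathrm{id})\Delta=\mathrm{id}_H,\quad \varepsilon\eta_L=\varepsilon\eta_R=\mathrm{id}_R,\quad \Delta\eta_L=\eta_L\otimes1,\quad \Delta\eta_R=1\otimes\eta_R,\quad (\mathrm{id}\otimes\Delta)\Delta=(\Delta\otimes\mathrm{id})\Delta .$$ Here $\mathrm{id}\otimes\varepsilon$, $\varepsilon\otimes\mathrm{id}$, $\Delta\otimes\mathrm{id}$, $\mathrm{id}\otimes\Delta$ send $F\in H\hat\otimes_RH$ to $F(\cdot,1)$, $F(1,\cdot)$, $F(uv,w)$, $F(u,vw)$ respectively; these maps are continuous and have the expected values on the elements $\varphi\otimes\psi$. Moreover, $H$ admits an antipode, which makes it a commutative Hopf algebroid: there is a continuous morphism of unital $k$-algebras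 $S:H\to H$ with $S\eta_L=\eta_R$ and $S\eta_R=\eta_L$, such that the maps $\varphi\otimes\psi\mapsto\varphi\,S(\psi)$ and $\varphi\otimes\psi\mapsto S(\varphi)\,\psi$ extend to continuous multiplicative $k$-linear maps $\mu(\mathrm{id}\otimes S),\ \mu(S\otimes\mathrm{id}):H\hat\otimes_RH\to H$ satisfying $$\mu(\mathrm{id}\otimes S)\Delta=\eta_L\varepsilon,\qquad \mu(S\otimes\mathrm{id})\Delta=\eta_R\varepsilon .$$ The extensions are the canonical ones: $\mu(S\otimes\mathrm{id})(F)(u)=\sum S\big(F(\cdot,u_2)\big)(u_1)$ and $\mu(\mathrm{id}\otimes S)(F)=S\big(\mu(S\otimes\mathrm{id})(F)\big)$ for all $F\in H\hat\otimes_RH$. -/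

import Mathlib

open scoped TensorProduct

noncomputable section

set_option linter.unusedSectionVars false

namespace LieRinehartDual

/-! ### The universal enveloping algebra of a Lie-Rinehart pair `(R, L)` over `k`

A Lie-Rinehart pair is given by Mathlib's classes `LieRinehartRing R L` and
`LieRinehartAlgebra k R L`; the anchor is written `x(r) = ⁅x, r⁆` for `x : L`, `r : R`. -/

/-- The Lie algebra `R ⊕ L`; its elements are written `⟨r, x⟩`. -/
@[ext] structure SemiSum (R L : Type*) where
  fst : R
  snd : L

namespace SemiSum

variable {k R L : Type*} [CommRing k] [CommRing R] [Algebra k R] [LieRing L] [LieAlgebra k L]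

/-- As a set, and as a `k`-module, `R ⊕ L` is the product. -/
def toProd : SemiSum R L ≃ R × L where
  toFun a := (a.fst, a.snd)
  invFun a := ⟨a.1, a.2⟩

instance : AddCommGroup (SemiSum R L) := toProd.addCommGroup
instance : Module k (SemiSum R L) := toProd.module k

@[simp] lemma fst_add (a b : SemiSum R L) : (a + b).fst = a.fst + b.fst := rfl
@[simp] lemma snd_add (a b : SemiSum R L) : (a + b).snd = a.snd + b.snd := rfl
@[simp] lemma fst_zero : (0 : SemiSum R L).fst = 0 := rfl
@[simp] lemma snd_zero : (0 : SemiSum R L).snd = 0 := rfl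
@[simp] lemma fst_smul (c : k) (a : SemiSum R L) : (c • a).fst = c • a.fst := rfl
@[simp] lemma snd_smul (c : k) (a : SemiSum R L) : (c • a).snd = c • a.snd := rfl

variable [LieRingModule L R]

instance : Bracket (SemiSum R L) (SemiSum R L) where
  bracket a b := ⟨⁅a.snd, b.fst⁆ - ⁅b.snd, a.fst⁆, ⁅a.snd, b.snd⁆⟩

@[simp] lemma fst_lie (a b : SemiSum R L) : ⁅a, b⁆.fst = ⁅a.snd, b.fst⁆ - ⁅b.snd, a.fst⁆ := rfl
@[simp] lemma snd_lie (a b : SemiSum R L) : ⁅a, b⁆.snd = ⁅a.snd, b.snd⁆ := rfl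

/-- The Lie ring structure `[(r₁, x₁), (r₂, x₂)] = (x₁(r₂) - x₂(r₁), [x₁, x₂])`. -/
instance : LieRing (SemiSum R L) where
  add_lie a b c := by ext <;> simp; abel
  lie_add a b c := by ext <;> simp; abel
  lie_self a := by ext <;> simp
  leibniz_lie a b c := by ext <;> simp; abel

instance [LieModule k L R] : LieAlgebra k (SemiSum R L) where
  lie_smul c a b := by
    have h : ⁅a.snd, c • b.fst⁆ = c • ⁅a.snd, b.fst⁆ := lie_smul c a.snd b.fst
    ext <;> simp [smul_sub, h]

variable (k R L) in
/-- The inclusion `r ↦ (r, 0)`. -/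
def inl : R →ₗ[k] SemiSum R L where
  toFun r := ⟨r, 0⟩
  map_add' a b := by ext <;> simp
  map_smul' c a := by ext <;> simp

variable (k R L) in
/-- The inclusion `x ↦ (0, x)`. -/
def inr : L →ₗ[k] SemiSum R L where
  toFun x := ⟨0, x⟩
  map_add' a b := by ext <;> simp
  map_smul' c a := by ext <;> simp

end SemiSum

section Enveloping

attribute [local instance 100] LieRing.ofAssociativeRing

variable (k R L : Type*) [CommRing k] [CommRing R] [Algebra k R] [LieRing L] [LieAlgebra k L]
  [Module R L] [LieRingModule L R] [LieRinehartRing R L] [LieRinehartAlgebra k R L]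

attribute [local instance] LieRinehartAlgebra.toLieModule

/-- The class of `(r, x) ∈ R ⊕ L` in the enveloping algebra of the `k`-Lie algebra `R ⊕ L`. -/
def gen (r : R) (x : L) : UniversalEnvelopingAlgebra k (SemiSum R L) :=
  UniversalEnvelopingAlgebra.ι k (⟨r, x⟩ : SemiSum R L)

/-- The relations `r' · (r + x) = r'r + r'x`. The last relation identifies the unit of `R` with the
unit of the algebra: in the quotient of the (non-unital) subalgebra generated by `R ⊕ L` the class
of `1 ∈ R` is a two-sided unit, so that quotient is the unital algebra presented here. -/
inductive Rel : UniversalEnvelopingAlgebra k (SemiSum R L) →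
    UniversalEnvelopingAlgebra k (SemiSum R L) → Prop
  | smul (r' r : R) (x : L) : Rel (gen k R L r' 0 * gen k R L r x) (gen k R L (r' * r) (r' • x))
  | one : Rel (gen k R L 1 0) 1

/-- The universal enveloping algebra `U(R, L)` of a Lie-Rinehart pair. -/
def U : Type _ := RingQuot (Rel k R L)

instance : Ring (U k R L) := inferInstanceAs (Ring (RingQuot (Rel k R L)))
instance : Algebra k (U k R L) := inferInstanceAs (Algebra k (RingQuot (Rel k R L)))

def mk : UniversalEnvelopingAlgebra k (SemiSum R L) →ₐ[k] U k R L :=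
  RingQuot.mkAlgHom k (Rel k R L)

lemma mk_rel {a b} (h : Rel k R L a b) : mk k R L a = mk k R L b :=
  RingQuot.mkAlgHom_rel k h

/-- The canonical `k`-linear map `R ⊕ L → U`. -/
def incl : SemiSum R L →ₗ[k] U k R L :=
  (mk k R L).toLinearMap ∘ₗ (UniversalEnvelopingAlgebra.ι k).toLinearMap

/-- The canonical map `R → U`. -/
def ofR : R →ₐ[k] U k R L :=
  AlgHom.ofLinearMap (incl k R L ∘ₗ SemiSum.inl k R L)
    ((mk_rel k R L Rel.one).trans (map_one _))
    (fun a b => by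
      have := mk_rel k R L (Rel.smul a b 0)
      rw [map_mul, smul_zero] at this
      exact this.symm)

/-- The canonical map `L → U`. -/
def ofL : L →ₗ[k] U k R L := incl k R L ∘ₗ SemiSum.inr k R L

/-- The left `R`-module structure on `U`, by left multiplication: `r • u = r u`. -/
instance : Module R (U k R L) := Module.compHom _ (ofR k R L).toRingHom

variable {k R L}

lemma smul_def (r : R) (u : U k R L) : r • u = ofR k R L r * u := rfl

instance : IsScalarTower R (U k R L) (U k R L) := ⟨fun r a b => by
  simp only [smul_eq_mul, smul_def, mul_assoc]⟩

instance : IsScalarTower k R (U k R L) := ⟨fun c r u => by simp [smul_def]⟩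

instance : SMulCommClass R k (U k R L) := ⟨fun r c u => by simp [smul_def]⟩
instance : SMulCommClass k R (U k R L) := ⟨fun c r u => by simp [smul_def]⟩

/-- The Lie algebra map on `R ⊕ L` given by compatible maps on `R` and on `L`. -/
def liftLie {A : Type*} [Ring A] [Algebra k A] (f : R →ₐ[k] A) (g : L →ₗ[k] A)
    (hLL : ∀ x y, g ⁅x, y⁆ = g x * g y - g y * g x)
    (hLR : ∀ (x : L) (r : R), f ⁅x, r⁆ = g x * f r - f r * g x) : SemiSum R L →ₗ⁅k⁆ A where
  toFun a := f a.fst + g a.snd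
  map_add' a b := by simp; abel
  map_smul' c a := by simp
  map_lie' := fun {a b} => by
    have : f a.fst * f b.fst = f b.fst * f a.fst := by rw [← map_mul, mul_comm, map_mul]
    simp only [SemiSum.fst_lie, SemiSum.snd_lie, map_sub, hLR, hLL,
      LieRing.of_associative_ring_bracket, mul_add, add_mul, this]
    abel

/-- The universal property of `U`: compatible maps on `R` and on `L` extend to `U`. -/
def lift {A : Type*} [Ring A] [Algebra k A] (f : R →ₐ[k] A) (g : L →ₗ[k] A)
    (hLL : ∀ x y, g ⁅x, y⁆ = g x * g y - g y * g x)
    (hLR : ∀ (x : L) (r : R), f ⁅x, r⁆ = g x * f r - f r * g x)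
    (hRL : ∀ (r : R) (x : L), g (r • x) = f r * g x) : U k R L →ₐ[k] A :=
  RingQuot.liftAlgHom k ⟨UniversalEnvelopingAlgebra.lift k (liftLie f g hLL hLR), by
    have key : ∀ (r : R) (x : L), UniversalEnvelopingAlgebra.lift k (liftLie f g hLL hLR)
      (gen k R L r x) = f r + g x := fun r x => UniversalEnvelopingAlgebra.lift_ι_apply k _ _
    intro a b h
    cases h with
    | smul r' r x => simp [key, hRL, mul_add]
    | one => simp [key]⟩

section lift
variable {A : Type*} [Ring A] [Algebra k A] (f : R →ₐ[k] A) (g : L →ₗ[k] A)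
    (hLL : ∀ x y, g ⁅x, y⁆ = g x * g y - g y * g x)
    (hLR : ∀ (x : L) (r : R), f ⁅x, r⁆ = g x * f r - f r * g x)
    (hRL : ∀ (r : R) (x : L), g (r • x) = f r * g x)

lemma lift_incl (a : SemiSum R L) : lift f g hLL hLR hRL (incl k R L a) = f a.fst + g a.snd :=
  (RingQuot.liftAlgHom_mkAlgHom_apply _ _ _ _).trans
    (UniversalEnvelopingAlgebra.lift_ι_apply k (liftLie f g hLL hLR) a)

@[simp] lemma lift_ofR (r : R) : lift f g hLL hLR hRL (ofR k R L r) = f r := by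
  refine (lift_incl f g hLL hLR hRL ⟨r, 0⟩).trans ?_
  simp

@[simp] lemma lift_ofL (x : L) : lift f g hLL hLR hRL (ofL k R L x) = g x := by
  refine (lift_incl f g hLL hLR hRL ⟨0, x⟩).trans ?_
  simp

end lift

lemma hom_ext {A : Type*} [Ring A] [Algebra k A] {F G : U k R L →ₐ[k] A}
    (hR : ∀ r, F (ofR k R L r) = G (ofR k R L r)) (hL : ∀ x, F (ofL k R L x) = G (ofL k R L x)) :
    F = G := by
  apply RingQuot.ringQuot_ext'
  apply UniversalEnvelopingAlgebra.hom_ext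
  ext a
  have key : ∀ F : U k R L →ₐ[k] A, F (incl k R L a) =
      F (ofR k R L a.fst) + F (ofL k R L a.snd) := fun F => by
    rw [← map_add]
    congr 1
    have : a = SemiSum.inl k R L a.fst + SemiSum.inr k R L a.snd := by
      ext <;> simp [SemiSum.inl, SemiSum.inr]
    rw [this, map_add]
    simp [ofR, ofL, SemiSum.inl, SemiSum.inr]
  exact (key F).trans ((by rw [hR, hL] : _ = _).trans (key G).symm)

lemma incl_lie (a b : SemiSum R L) :
    incl k R L ⁅a, b⁆ = incl k R L a * incl k R L b - incl k R L b * incl k R L a := by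
  have h := congrArg (mk k R L) (LieHom.map_lie (UniversalEnvelopingAlgebra.ι k) a b)
  rw [LieRing.of_associative_ring_bracket, map_sub, map_mul, map_mul] at h
  exact h

lemma ofL_lie (x y : L) :
    ofL k R L ⁅x, y⁆ = ofL k R L x * ofL k R L y - ofL k R L y * ofL k R L x := by
  have h := incl_lie (k := k) (⟨0, x⟩ : SemiSum R L) ⟨0, y⟩
  rw [show ⁅(⟨0, x⟩ : SemiSum R L), (⟨0, y⟩ : SemiSum R L)⁆ = ⟨0, ⁅x, y⁆⟩ by ext <;> simp] at h
  exact h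

lemma ofR_lie (x : L) (r : R) :
    ofR k R L ⁅x, r⁆ = ofL k R L x * ofR k R L r - ofR k R L r * ofL k R L x := by
  have h := incl_lie (k := k) (⟨0, x⟩ : SemiSum R L) ⟨r, 0⟩
  rw [show ⁅(⟨0, x⟩ : SemiSum R L), (⟨r, 0⟩ : SemiSum R L)⁆ = ⟨⁅x, r⁆, 0⟩ by ext <;> simp] at h
  exact h

lemma ofL_smul (r : R) (x : L) : ofL k R L (r • x) = ofR k R L r * ofL k R L x := by
  have h := mk_rel k R L (Rel.smul r 0 x)
  rw [map_mul, mul_zero] at h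
  exact h.symm

/-- `U` is generated as an algebra by `R` and `L`. -/
lemma mem_subalgebra (S : Subalgebra k (U k R L)) (hR : ∀ r, ofR k R L r ∈ S)
    (hL : ∀ x, ofL k R L x ∈ S) (u : U k R L) : u ∈ S := by
  let F : U k R L →ₐ[k] S := lift ((ofR k R L).codRestrict S hR)
    ((ofL k R L).codRestrict (Subalgebra.toSubmodule S) hL)
    (fun x y => Subtype.ext (ofL_lie x y)) (fun x r => Subtype.ext (ofR_lie x r))
    (fun r x => Subtype.ext (ofL_smul r x))
  have h : S.val.comp F = AlgHom.id k _ := by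
    apply hom_ext
    · intro r; simp [F]
    · intro x; simp [F]; rfl
  have := DFunLike.congr_fun h u
  rw [← show S.val (F u) = u from this]
  exact (F u).2

/-! ### The left `R`-bialgebra structure of `U` -/

variable (k R L) in
/-- The action of `U` on `R`: elements of `R` act by multiplication, elements of `L` through the
anchor. -/
def act : U k R L →ₐ[k] Module.End k R :=
  lift (Algebra.lmul k R) (LieModule.toEnd k L R : L →ₗ[k] Module.End k R)
    (fun x y => by ext r; simp)
    (fun x r => by ext s; simp)
    (fun r x => by ext s; simp)

variable (k R L) in
/-- The counit (augmentation) `ε(u) = u · 1` of `U`. -/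
def counit : U k R L →ₗ[R] R where
  toFun u := act k R L u 1
  map_add' u v := by simp
  map_smul' r u := by simp [smul_def, act]

variable (k R L) in
/-- The biadditive map `(u, v) ↦ x u ⊗ v + u ⊗ x v`. -/
def diagAux (x : L) : U k R L →+ U k R L →+ U k R L ⊗[R] U k R L :=
  AddMonoidHom.mk' (fun u => AddMonoidHom.mk'
      (fun v => (ofL k R L x * u) ⊗ₜ[R] v + u ⊗ₜ[R] (ofL k R L x * v))
      (fun v w => by simp only [mul_add, TensorProduct.tmul_add]; abel))
    (fun u w => AddMonoidHom.ext fun v => by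
      simp only [AddMonoidHom.mk'_apply, AddMonoidHom.add_apply, mul_add, TensorProduct.add_tmul]
      abel)

lemma ofL_mul_smul (x : L) (r : R) (w : U k R L) :
    ofL k R L x * r • w = ⁅x, r⁆ • w + r • (ofL k R L x * w) := by
  simp only [smul_def, ofR_lie, sub_mul, mul_assoc, sub_add_cancel]

lemma diagAux_balanced (x : L) (r : R) (u v : U k R L) :
    diagAux k R L x (r • u) v = diagAux k R L x u (r • v) := by
  simp only [diagAux, AddMonoidHom.mk'_apply, ofL_mul_smul, TensorProduct.add_tmul,
    TensorProduct.tmul_add, TensorProduct.smul_tmul]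
  abel

variable (k R L) in
/-- The operator `u ⊗ v ↦ x u ⊗ v + u ⊗ x v` on `U ⊗_R U` (tensor product of left `R`-modules). -/
def diagL (x : L) : U k R L ⊗[R] U k R L →ₗ[k] U k R L ⊗[R] U k R L where
  toFun := TensorProduct.liftAddHom (diagAux k R L x) (diagAux_balanced x)
  map_add' a b := map_add _ a b
  map_smul' c a := by
    induction a with
    | zero => rw [smul_zero, map_zero, smul_zero]
    | add a b ha hb => rw [smul_add, map_add, ha, hb, map_add, smul_add]
    | tmul u v =>
      rw [RingHom.id_apply, TensorProduct.smul_tmul', TensorProduct.liftAddHom_tmul,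
        TensorProduct.liftAddHom_tmul]
      simp only [diagAux, AddMonoidHom.mk'_apply, mul_smul_comm, smul_add,
        TensorProduct.smul_tmul']

@[simp] lemma diagL_tmul (x : L) (u v : U k R L) :
    diagL k R L x (u ⊗ₜ v) = (ofL k R L x * u) ⊗ₜ[R] v + u ⊗ₜ[R] (ofL k R L x * v) := rfl

lemma end_ext {f g : Module.End k (U k R L ⊗[R] U k R L)}
    (h : ∀ u v, f (u ⊗ₜ v) = g (u ⊗ₜ v)) : f = g := by
  ext t
  induction t with
  | zero => simp
  | add a b ha hb => simp [ha, hb]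
  | tmul u v => exact h u v

variable (k R L) in
/-- The diagonal action of `U` on `U ⊗_R U`: `r ∈ R` acts by the left `R`-module structure and
`x ∈ L` by `x · (u ⊗ v) = x u ⊗ v + u ⊗ x v`. -/
def diag : U k R L →ₐ[k] Module.End k (U k R L ⊗[R] U k R L) :=
  lift (Algebra.lsmul k k (U k R L ⊗[R] U k R L))
    { toFun := diagL k R L
      map_add' := fun x y => end_ext fun u v => by
        simp only [diagL_tmul, map_add, add_mul, TensorProduct.add_tmul, TensorProduct.tmul_add,
          LinearMap.add_apply]
        abel
      map_smul' := fun c x => end_ext fun u v => by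
        simp only [diagL_tmul, map_smul, smul_mul_assoc, TensorProduct.smul_tmul',
          TensorProduct.smul_tmul, LinearMap.smul_apply, smul_add, RingHom.id_apply] }
    (fun x y => end_ext fun u v => by
      simp only [LinearMap.coe_mk, AddHom.coe_mk, diagL_tmul, ofL_lie, sub_mul, mul_assoc,
        TensorProduct.sub_tmul, TensorProduct.tmul_sub, LinearMap.sub_apply, Module.End.mul_apply,
        map_add]
      abel)
    (fun x r => end_ext fun u v => by
      simp only [LinearMap.coe_mk, AddHom.coe_mk, LinearMap.sub_apply, Module.End.mul_apply,
        Algebra.lsmul_coe, TensorProduct.smul_tmul', diagL_tmul, ofL_mul_smul, smul_add,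
        TensorProduct.add_tmul]
      abel)
    (fun r x => end_ext fun u v => by
      simp only [LinearMap.coe_mk, AddHom.coe_mk, Module.End.mul_apply, Algebra.lsmul_coe,
        diagL_tmul, ofL_smul, ← smul_def, smul_mul_assoc, smul_add, TensorProduct.smul_tmul',
        TensorProduct.smul_tmul])

variable (k R L) in
/-- The coproduct `Δ(u) = u · (1 ⊗ 1)` of `U`, so that `Δ(r) = r ⊗ 1 = 1 ⊗ r` for `r ∈ R` and
`Δ(x) = x ⊗ 1 + 1 ⊗ x` for `x ∈ L`. -/
def comul : U k R L →ₗ[R] U k R L ⊗[R] U k R L where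
  toFun u := diag k R L u (1 ⊗ₜ 1)
  map_add' u v := by simp
  map_smul' r u := by simp [smul_def, diag]

variable (k R L) in
/-- Right multiplication `u ↦ u a` on `U`. -/
def rmul (a : U k R L) : U k R L →ₗ[R] U k R L where
  toFun u := u * a
  map_add' u v := add_mul u v a
  map_smul' r u := smul_mul_assoc r u a

@[simp] lemma rmul_apply (a u : U k R L) : rmul k R L a u = u * a := rfl

lemma diag_map_rmul (u a b : U k R L) (t : U k R L ⊗[R] U k R L) :
    diag k R L u (TensorProduct.map (rmul k R L a) (rmul k R L b) t) =
      TensorProduct.map (rmul k R L a) (rmul k R L b) (diag k R L u t) := by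
  let ρ : Module.End k (U k R L ⊗[R] U k R L) :=
    (TensorProduct.map (rmul k R L a) (rmul k R L b)).restrictScalars k
  have h := mem_subalgebra ((Subalgebra.centralizer k {ρ}).comap (diag k R L)) ?_ ?_ u
  · have h' := (Subalgebra.mem_centralizer_iff k).1 h ρ rfl
    exact (DFunLike.congr_fun h' t).symm
  · intro r
    refine (Subalgebra.mem_centralizer_iff k).2 ?_
    rintro _ rfl
    exact end_ext fun u v => by simp [ρ, diag, TensorProduct.smul_tmul']
  · intro x
    refine (Subalgebra.mem_centralizer_iff k).2 ?_
    rintro _ rfl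
    exact end_ext fun u v => by simp [ρ, diag, mul_assoc]

/-- The coproduct takes values in the locus where the two right `R`-module structures of
`U ⊗_R U` coincide, and it is compatible with right multiplication by `r ∈ R`. -/
lemma comul_mul_ofR (u : U k R L) (r : R) :
    comul k R L (u * ofR k R L r) =
      TensorProduct.map (rmul k R L (ofR k R L r)) LinearMap.id (comul k R L u) := by
  have h1 : (LinearMap.id : U k R L →ₗ[R] U k R L) = rmul k R L 1 := by ext; simp
  change diag k R L (u * ofR k R L r) (1 ⊗ₜ 1) = TensorProduct.map _ _ (diag k R L u (1 ⊗ₜ 1))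
  rw [h1, ← diag_map_rmul, map_mul, Module.End.mul_apply]
  congr 1
  simp [diag, TensorProduct.smul_tmul', smul_def]

lemma comul_mul_ofR' (u : U k R L) (r : R) :
    comul k R L (u * ofR k R L r) =
      TensorProduct.map LinearMap.id (rmul k R L (ofR k R L r)) (comul k R L u) := by
  have h1 : (LinearMap.id : U k R L →ₗ[R] U k R L) = rmul k R L 1 := by ext; simp
  change diag k R L (u * ofR k R L r) (1 ⊗ₜ 1) = TensorProduct.map _ _ (diag k R L u (1 ⊗ₜ 1))
  rw [h1, ← diag_map_rmul, map_mul, Module.End.mul_apply]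
  congr 1
  have h : ofR k R L r = r • (1 : U k R L) := by simp [smul_def]
  have h' : (1 : U k R L) ⊗ₜ[R] ofR k R L r = ofR k R L r ⊗ₜ[R] 1 := by
    rw [h, TensorProduct.smul_tmul]
  simp [diag, TensorProduct.smul_tmul', smul_def, h']

/-! ### The dual `H = Hom_R(U, R)` and its completed tensor powers -/

variable (k R L) in
/-- `H = Hom_R(U, R)`, the homomorphisms of left `R`-modules. -/
abbrev Dual : Type _ := U k R L →ₗ[R] R

variable (k R L) in
/-- The completed tensor square of `H` over `R`, formed with respect to the right unit on the left
factor and the left unit on the right factor: it is `Hom_R(U ⊗_R U, R)`, where `U ⊗_R U` is the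
tensor product of `R`-bimodules (`u r ⊗ v = u ⊗ r v`), with its left `R`-module structure. Its
elements are written as balanced biadditive functions `F(u, v)` which are left `R`-linear
in `u`. -/
def Dual₂ : Submodule k (U k R L →ₗ[k] U k R L →ₗ[k] R) where
  carrier := {F | (∀ (r : R) u v, F (r • u) v = r * F u v) ∧
    ∀ u (r : R) v, F (u * ofR k R L r) v = F u (r • v)}
  add_mem' := fun ⟨h1, h2⟩ ⟨h3, h4⟩ => ⟨fun r u v => by simp [h1, h3, mul_add],
    fun u r v => by simp [h2, h4]⟩
  zero_mem' := ⟨by simp, by simp⟩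
  smul_mem' c F := fun ⟨h1, h2⟩ => ⟨fun r u v => by simp [h1], fun u r v => by simp [h2]⟩

variable (k R L) in
/-- The completed tensor cube of `H` over `R`, that is, `Hom_R(U ⊗_R U ⊗_R U, R)`. -/
def Dual₃ : Submodule k (U k R L →ₗ[k] U k R L →ₗ[k] U k R L →ₗ[k] R) where
  carrier := {F | (∀ (r : R) u v w, F (r • u) v w = r * F u v w) ∧
    (∀ u (r : R) v w, F (u * ofR k R L r) v w = F u (r • v) w) ∧
    ∀ u v (r : R) w, F u (v * ofR k R L r) w = F u v (r • w)}
  add_mem' := fun ⟨h1, h2, h3⟩ ⟨h4, h5, h6⟩ => ⟨fun r u v w => by simp [h1, h4, mul_add],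
    fun u r v w => by simp [h2, h5], fun u v r w => by simp [h3, h6]⟩
  zero_mem' := ⟨by simp, by simp, by simp⟩
  smul_mem' c F := fun ⟨h1, h2, h3⟩ => ⟨fun r u v w => by simp [h1],
    fun u r v w => by simp [h2], fun u v r w => by simp [h3]⟩

set_option maxSynthPendingDepth 5 in
instance : AddCommGroup (Dual₃ k R L) := inferInstance
set_option maxSynthPendingDepth 5 in
instance : Module k (Dual₃ k R L) := inferInstance

/-- The topology of pointwise convergence on `H`. -/
instance [TopologicalSpace R] : TopologicalSpace (Dual k R L) :=
  TopologicalSpace.induced (fun φ (u : U k R L) => φ u) inferInstance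

/-- The topology of pointwise convergence on the completed tensor square. -/
instance [TopologicalSpace R] : TopologicalSpace (Dual₂ k R L) :=
  TopologicalSpace.induced (fun F (p : U k R L × U k R L) => F.1 p.1 p.2) inferInstance

/-- The topology of pointwise convergence on the completed tensor cube. -/
instance [TopologicalSpace R] : TopologicalSpace (Dual₃ k R L) :=
  TopologicalSpace.induced
    (fun F (p : U k R L × U k R L × U k R L) => F.1 p.1 p.2.1 p.2.2) inferInstance

variable (k R L) in
/-- The product of `H`, dual to the coproduct of `U`: `(φψ)(u) = ∑ φ(u₁) ψ(u₂)` where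
`Δ(u) = ∑ u₁ ⊗ u₂`. -/
def dualMul : Dual k R L →ₗ[k] Dual k R L →ₗ[k] Dual k R L :=
  LinearMap.mk₂ k (fun φ ψ => LinearMap.mul' R R ∘ₗ TensorProduct.map φ ψ ∘ₗ comul k R L)
    (fun φ φ' ψ => by
      rw [TensorProduct.map_add_left, LinearMap.add_comp, LinearMap.comp_add])
    (fun c φ ψ => by
      ext u
      have h : ∀ t, LinearMap.mul' R R (TensorProduct.map (c • φ) ψ t) =
          c • LinearMap.mul' R R (TensorProduct.map φ ψ t) := fun t => by
        induction t with
        | zero => simp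
        | add a b ha hb => simp only [map_add, ha, hb, smul_add]
        | tmul a b => simp
      exact h _)
    (fun φ ψ ψ' => by
      rw [TensorProduct.map_add_right, LinearMap.add_comp, LinearMap.comp_add])
    (fun c φ ψ => by
      ext u
      have h : ∀ t, LinearMap.mul' R R (TensorProduct.map φ (c • ψ) t) =
          c • LinearMap.mul' R R (TensorProduct.map φ ψ t) := fun t => by
        induction t with
        | zero => simp
        | add a b ha hb => simp only [map_add, ha, hb, smul_add]
        | tmul a b => simp
      exact h _)

lemma dualMul_apply (φ ψ : Dual k R L) (u : U k R L) :
    dualMul k R L φ ψ u = LinearMap.mul' R R (TensorProduct.map φ ψ (comul k R L u)) := rfl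

lemma dualMul_rmul_left (φ ψ : Dual k R L) (r : R) (u : U k R L) :
    dualMul k R L (φ ∘ₗ rmul k R L (ofR k R L r)) ψ u = dualMul k R L φ ψ (u * ofR k R L r) := by
  rw [dualMul_apply, dualMul_apply, comul_mul_ofR, ← LinearMap.comp_apply (TensorProduct.map φ ψ),
    ← TensorProduct.map_comp, LinearMap.comp_id]

lemma dualMul_rmul_right (φ ψ : Dual k R L) (r : R) (u : U k R L) :
    dualMul k R L φ (ψ ∘ₗ rmul k R L (ofR k R L r)) u = dualMul k R L φ ψ (u * ofR k R L r) := by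
  rw [dualMul_apply, dualMul_apply, comul_mul_ofR', ← LinearMap.comp_apply (TensorProduct.map φ ψ),
    ← TensorProduct.map_comp, LinearMap.comp_id]

/-- For `F` in the completed tensor square and `v ∈ U`, the functional `u ↦ F(u, v)` of `H`. -/
def slice (F : Dual₂ k R L) : U k R L →ₗ[k] Dual k R L where
  toFun v :=
    { toFun := fun u => F.1 u v
      map_add' := by simp
      map_smul' := fun r u => F.2.1 r u v }
  map_add' v w := by ext u; simp
  map_smul' c v := by ext u; simp

@[simp] lemma slice_apply (F : Dual₂ k R L) (u v : U k R L) : slice F v u = F.1 u v := rfl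

lemma slice_smul (F : Dual₂ k R L) (r : R) (v : U k R L) :
    slice F (r • v) = slice F v ∘ₗ rmul k R L (ofR k R L r) := by
  ext u; exact (F.2.2 u r v).symm

lemma slice_balanced (F G : Dual₂ k R L) (r : R) (v w : U k R L) :
    dualMul k R L (slice F (r • v)) (slice G w) = dualMul k R L (slice F v) (slice G (r • w)) := by
  ext u
  rw [slice_smul, slice_smul, dualMul_rmul_left, dualMul_rmul_right]

/-- The map `v ⊗ w ↦ F(-, v) G(-, w)` from `U ⊗_R U` (left modules) to `H`. -/
def sliceMul (F G : Dual₂ k R L) : U k R L ⊗[R] U k R L →+ Dual k R L :=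
  TensorProduct.liftAddHom
    (AddMonoidHom.mk' (fun v => AddMonoidHom.mk'
        (fun w => dualMul k R L (slice F v) (slice G w)) (fun w w' => by simp))
      (fun v v' => by ext w : 1; simp))
    (slice_balanced F G)

@[simp] lemma sliceMul_tmul (F G : Dual₂ k R L) (v w : U k R L) :
    sliceMul F G (v ⊗ₜ w) = dualMul k R L (slice F v) (slice G w) := rfl

lemma sliceMul_smul (F G : Dual₂ k R L) (r : R) (t : U k R L ⊗[R] U k R L) (u : U k R L) :
    sliceMul F G (r • t) u = sliceMul F G t (u * ofR k R L r) := by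
  induction t with
  | zero => simp
  | add a b ha hb => simp only [smul_add, map_add, LinearMap.add_apply, ha, hb]
  | tmul v w => rw [TensorProduct.smul_tmul', sliceMul_tmul, sliceMul_tmul, slice_smul,
      dualMul_rmul_left]

lemma sliceMul_smul' (F G : Dual₂ k R L) (c : k) (t : U k R L ⊗[R] U k R L) :
    sliceMul F G (c • t) = c • sliceMul F G t := by
  induction t with
  | zero => simp
  | add a b ha hb => simp only [smul_add, map_add, ha, hb]
  | tmul v w => rw [TensorProduct.smul_tmul', sliceMul_tmul, sliceMul_tmul, map_smul, map_smul,
      LinearMap.smul_apply]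

lemma comul_smul (c : k) (u : U k R L) : comul k R L (c • u) = c • comul k R L u := by
  simp [comul]

/-- The product `(FG)(u, v) = ∑ F(u₁, v₁) G(u₂, v₂)` of two elements of the completed tensor
square. -/
def dualMul₂Fun (F G : Dual₂ k R L) : Dual₂ k R L :=
  ⟨LinearMap.mk₂ k (fun u v => sliceMul F G (comul k R L v) u)
      (fun u u' v => by simp)
      (fun c u v => by simp)
      (fun u v v' => by simp)
      (fun c u v => by rw [comul_smul, sliceMul_smul', LinearMap.smul_apply]),
    fun r u v => by simp, fun u r v => by simp [sliceMul_smul]⟩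

lemma dualMul₂Fun_apply (F G : Dual₂ k R L) (u v : U k R L) :
    (dualMul₂Fun F G).1 u v = sliceMul F G (comul k R L v) u := rfl

lemma slice_add (F F' : Dual₂ k R L) (v : U k R L) : slice (F + F') v = slice F v + slice F' v :=
  rfl

lemma slice_smul' (c : k) (F : Dual₂ k R L) (v : U k R L) : slice (c • F) v = c • slice F v := rfl

lemma sliceMul_ext {f g : U k R L ⊗[R] U k R L →+ Dual k R L}
    (h : ∀ v w, f (v ⊗ₜ w) = g (v ⊗ₜ w)) : f = g := by
  ext t : 1
  induction t with
  | zero => simp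
  | add a b ha hb => simp only [map_add, ha, hb]
  | tmul v w => exact h v w

variable (k R L) in
/-- The product of the completed tensor square, as a `k`-bilinear map. -/
def dualMul₂ : Dual₂ k R L →ₗ[k] Dual₂ k R L →ₗ[k] Dual₂ k R L :=
  LinearMap.mk₂ k dualMul₂Fun
    (fun F F' G => by
      have h : sliceMul (F + F') G = sliceMul F G + sliceMul F' G :=
        sliceMul_ext fun v w => by simp [slice_add]
      ext u v
      simp [dualMul₂Fun_apply, h])
    (fun c F G => by
      have h : sliceMul (c • F) G = c • sliceMul F G :=
        sliceMul_ext fun v w => by simp [slice_smul']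
      ext u v
      simp [dualMul₂Fun_apply, h])
    (fun F G G' => by
      have h : sliceMul F (G + G') = sliceMul F G + sliceMul F G' :=
        sliceMul_ext fun v w => by simp [slice_add]
      ext u v
      simp [dualMul₂Fun_apply, h])
    (fun c F G => by
      have h : sliceMul F (c • G) = c • sliceMul F G :=
        sliceMul_ext fun v w => by simp [slice_smul']
      ext u v
      simp [dualMul₂Fun_apply, h])

variable (k R L) in
/-- The unit of `H`: the counit `ε` of `U`. -/
def dualOne : Dual k R L := counit k R L

variable (k R L) in
/-- The left unit: `η_L(r)(u) = r ε(u)`. -/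
def etaL : R →ₗ[k] Dual k R L where
  toFun r := r • counit k R L
  map_add' r s := add_smul r s _
  map_smul' c r := smul_assoc c r _

variable (k R L) in
/-- The right unit: `η_R(r)(u) = u · r`, which is `ε(u r)`. -/
def etaR : R →ₗ[k] Dual k R L where
  toFun r :=
    { toFun := fun u => act k R L u r
      map_add' := by simp
      map_smul' := fun s u => by simp [smul_def, act] }
  map_add' r s := by ext u; exact map_add (act k R L u) r s
  map_smul' c r := by ext u; exact map_smul (act k R L u) c r

variable (k R L) in
/-- The counit of `H`, dual to the unit of `U`: `φ ↦ φ(1)`. -/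
def dualCounit : Dual k R L →ₗ[k] R where
  toFun φ := φ 1
  map_add' _ _ := rfl
  map_smul' _ _ := rfl

variable (k R L) in
/-- The coproduct of `H`, dual to the product of `U`: `Δ(φ)(u, v) = φ(u v)`. -/
def dualComul : Dual k R L →ₗ[k] Dual₂ k R L where
  toFun φ := ⟨(LinearMap.mul k (U k R L)).compr₂ (φ.restrictScalars k),
    fun r u v => by simp [smul_mul_assoc], fun u r v => by simp [smul_def, mul_assoc]⟩
  map_add' _ _ := rfl
  map_smul' _ _ := rfl

variable (k R L) in
/-- The canonical map `H × H → H ⊗̂_R H`: `(φ ⊗ ψ)(u, v) = φ(u ψ(v))`. -/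
def tmul : Dual k R L →ₗ[k] Dual k R L →ₗ[k] Dual₂ k R L :=
  LinearMap.mk₂ k
    (fun φ ψ => ⟨LinearMap.mk₂ k (fun u v => φ (u * ofR k R L (ψ v)))
        (fun u u' v => by rw [add_mul, map_add])
        (fun c u v => by rw [smul_mul_assoc, LinearMap.map_smul_of_tower])
        (fun u v v' => by rw [map_add, map_add, mul_add, map_add])
        (fun c u v => by
          rw [LinearMap.map_smul_of_tower, map_smul, mul_smul_comm, LinearMap.map_smul_of_tower]),
      fun r u v => by simp [smul_mul_assoc], fun u r v => by simp [mul_assoc]⟩)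
    (fun φ φ' ψ => rfl)
    (fun c φ ψ => rfl)
    (fun φ ψ ψ' => by ext u v; simp [mul_add])
    (fun c φ ψ => by ext u v; simp [LinearMap.map_smul_of_tower])

/-- A trilinear function as an iterated linear map. -/
def mk₃ (f : U k R L → U k R L →ₗ[k] U k R L →ₗ[k] R)
    (h1 : ∀ u u' v w, f (u + u') v w = f u v w + f u' v w)
    (h2 : ∀ (c : k) u v w, f (c • u) v w = c • f u v w) :
    U k R L →ₗ[k] U k R L →ₗ[k] U k R L →ₗ[k] R where
  toFun := f
  map_add' u u' := by ext v w; exact h1 u u' v w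
  map_smul' c u := by ext v w; exact h2 c u v w

/-- The canonical map `(H ⊗̂_R H) × H → H ⊗̂_R H ⊗̂_R H`: `(F ⊗ χ)(u, v, w) = F(u, v χ(w))`. -/
def tmul₂₁ (F : Dual₂ k R L) (χ : Dual k R L) : Dual₃ k R L :=
  ⟨mk₃ (fun u => LinearMap.mk₂ k (fun v w => F.1 u (v * ofR k R L (χ w)))
      (fun v v' w => by rw [add_mul, map_add])
      (fun c v w => by rw [smul_mul_assoc, map_smul])
      (fun v w w' => by rw [map_add, map_add, mul_add, map_add])
      (fun c v w => by rw [LinearMap.map_smul_of_tower, map_smul, mul_smul_comm, map_smul]))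
    (fun u u' v w => by simp) (fun c u v w => by simp),
   fun r u v w => F.2.1 r u _,
   fun u r v w => by
    change F.1 (u * ofR k R L r) (v * ofR k R L (χ w)) = F.1 u (r • v * ofR k R L (χ w))
    rw [F.2.2, smul_mul_assoc],
   fun u v r w => by simp [mk₃, mul_assoc]⟩

/-- The canonical map `H × (H ⊗̂_R H) → H ⊗̂_R H ⊗̂_R H`: `(φ ⊗ G)(u, v, w) = φ(u G(v, w))`. -/
def tmul₁₂ (φ : Dual k R L) (G : Dual₂ k R L) : Dual₃ k R L :=
  ⟨mk₃ (fun u => LinearMap.mk₂ k (fun v w => φ (u * ofR k R L (G.1 v w)))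
      (fun v v' w => by simp [mul_add])
      (fun c v w => by
        rw [map_smul, LinearMap.smul_apply, map_smul, mul_smul_comm, LinearMap.map_smul_of_tower])
      (fun v w w' => by simp [mul_add])
      (fun c v w => by rw [map_smul, map_smul, mul_smul_comm, LinearMap.map_smul_of_tower]))
    (fun u u' v w => by simp [add_mul])
    (fun c u v w => by
      simp only [LinearMap.mk₂_apply, smul_mul_assoc, LinearMap.map_smul_of_tower]),
   fun r u v w => by simp [mk₃, smul_mul_assoc],
   fun u r v w => by
    change φ (u * ofR k R L r * ofR k R L (G.1 v w)) = φ (u * ofR k R L (G.1 (r • v) w))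
    rw [G.2.1, mul_assoc, ← map_mul],
   fun u v r w => by
    change φ (u * ofR k R L (G.1 (v * ofR k R L r) w)) = φ (u * ofR k R L (G.1 v (r • w)))
    rw [G.2.2]⟩

variable (k R L) in
/-- The map `id ⊗ ε : H ⊗̂_R H → H`, `F ↦ F(-, 1)`. -/
def idCounit : Dual₂ k R L →ₗ[k] Dual k R L where
  toFun F := slice F 1
  map_add' _ _ := rfl
  map_smul' _ _ := rfl

variable (k R L) in
/-- The map `ε ⊗ id : H ⊗̂_R H → H`, `F ↦ F(1, -)`. -/
def counitId : Dual₂ k R L →ₗ[k] Dual k R L where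
  toFun F :=
    { toFun := fun v => F.1 1 v
      map_add' := by simp
      map_smul' := fun r v => by
        have h : (1 : U k R L) * ofR k R L r = r • 1 := by simp [smul_def]
        rw [← F.2.2, h, F.2.1]
        rfl }
  map_add' _ _ := rfl
  map_smul' _ _ := rfl

variable (k R L) in
/-- The map `Δ ⊗ id : H ⊗̂_R H → H ⊗̂_R H ⊗̂_R H`, `F ↦ ((u, v, w) ↦ F(u v, w))`. -/
def comulId : Dual₂ k R L →ₗ[k] Dual₃ k R L where
  toFun F := ⟨mk₃ (fun u => F.1 ∘ₗ LinearMap.mul k (U k R L) u)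
      (fun u u' v w => by simp) (fun c u v w => by simp),
    fun r u v w => by simpa [mk₃, smul_mul_assoc] using F.2.1 r (u * v) w,
    fun u r v w => by simp [mk₃, smul_def, mul_assoc],
    fun u v r w => by simpa [mk₃, mul_assoc] using F.2.2 (u * v) r w⟩
  map_add' _ _ := rfl
  map_smul' _ _ := rfl

variable (k R L) in
/-- The map `id ⊗ Δ : H ⊗̂_R H → H ⊗̂_R H ⊗̂_R H`, `F ↦ ((u, v, w) ↦ F(u, v w))`. -/
def idComul : Dual₂ k R L →ₗ[k] Dual₃ k R L where
  toFun F := ⟨mk₃ (fun u => (LinearMap.mul k (U k R L)).compr₂ (F.1 u))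
      (fun u u' v w => by simp) (fun c u v w => by simp),
    fun r u v w => F.2.1 r u (v * w),
    fun u r v w => by simpa [mk₃, smul_mul_assoc] using F.2.2 u r (v * w),
    fun u v r w => by simp [mk₃, smul_def, mul_assoc]⟩
  map_add' _ _ := rfl
  map_smul' _ _ := rfl

end Enveloping

/-! ### Commutative bialgebroids and Hopf algebroids -/

/-- The data of a topological commutative bialgebroid `(R, H)` over `k`, where `H₂` and `H₃` are the
completed tensor powers `H ⊗̂_R H` and `H ⊗̂_R H ⊗̂_R H` formed with respect to the right unit on the
left factor and the left unit on the right factor, together with their canonical maps. -/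
structure BialgebroidData (k R H H₂ H₃ : Type*) [CommRing k] [CommRing R] [Algebra k R]
    [AddCommGroup H] [Module k H] [AddCommGroup H₂] [Module k H₂] [AddCommGroup H₃]
    [Module k H₃] where
  /-- the product of `H` -/
  mul : H →ₗ[k] H →ₗ[k] H
  /-- the unit element of `H` -/
  one : H
  /-- the left unit (source map) -/
  ηL : R →ₗ[k] H
  /-- the right unit (target map) -/
  ηR : R →ₗ[k] H
  /-- the comultiplication -/
  Δ : H →ₗ[k] H₂
  /-- the counit -/
  ε : H →ₗ[k] R
  /-- `(φ, ψ) ↦ φ ⊗ ψ` -/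
  tmul : H →ₗ[k] H →ₗ[k] H₂
  /-- the product of `H ⊗̂_R H` -/
  mul₂ : H₂ →ₗ[k] H₂ →ₗ[k] H₂
  /-- `(F, χ) ↦ F ⊗ χ` -/
  tmul₂₁ : H₂ → H → H₃
  /-- `(φ, G) ↦ φ ⊗ G` -/
  tmul₁₂ : H → H₂ → H₃
  /-- `id ⊗ ε` -/
  idε : H₂ →ₗ[k] H
  /-- `ε ⊗ id` -/
  εid : H₂ →ₗ[k] H
  /-- `Δ ⊗ id` -/
  Δid : H₂ →ₗ[k] H₃
  /-- `id ⊗ Δ` -/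
  idΔ : H₂ →ₗ[k] H₃

namespace BialgebroidData

variable {k R H H₂ H₃ : Type*} [CommRing k] [CommRing R] [Algebra k R]
  [AddCommGroup H] [Module k H] [AddCommGroup H₂] [Module k H₂] [AddCommGroup H₃] [Module k H₃]
  [TopologicalSpace R] [TopologicalSpace H] [TopologicalSpace H₂] [TopologicalSpace H₃]

/-- The axioms of a topological, unital and counital commutative bialgebroid. -/
structure IsBialgebroid (B : BialgebroidData k R H H₂ H₃) : Prop where
  -- `H` is a topological commutative associative unital `k`-algebra
  mul_comm : ∀ φ ψ, B.mul φ ψ = B.mul ψ φ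
  mul_assoc : ∀ φ ψ χ, B.mul (B.mul φ ψ) χ = B.mul φ (B.mul ψ χ)
  one_mul : ∀ φ, B.mul B.one φ = φ
  continuous_add : Continuous fun p : H × H => p.1 + p.2
  continuous_mul : Continuous fun p : H × H => B.mul p.1 p.2
  -- so is its completed tensor square, with unit `1 ⊗ 1`
  mul₂_comm : ∀ F G, B.mul₂ F G = B.mul₂ G F
  mul₂_assoc : ∀ F G K, B.mul₂ (B.mul₂ F G) K = B.mul₂ F (B.mul₂ G K)
  one_mul₂ : ∀ F, B.mul₂ (B.tmul B.one B.one) F = F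
  continuous_add₂ : Continuous fun p : H₂ × H₂ => p.1 + p.2
  continuous_mul₂ : Continuous fun p : H₂ × H₂ => B.mul₂ p.1 p.2
  -- the canonical maps into the completed tensor powers
  tmul_balanced : ∀ φ r ψ, B.tmul (B.mul φ (B.ηR r)) ψ = B.tmul φ (B.mul (B.ηL r) ψ)
  tmul_mul : ∀ φ ψ φ' ψ', B.mul₂ (B.tmul φ ψ) (B.tmul φ' ψ') = B.tmul (B.mul φ φ') (B.mul ψ ψ')
  continuous_tmul : Continuous fun p : H × H => B.tmul p.1 p.2
  tmul_assoc : ∀ φ ψ χ, B.tmul₂₁ (B.tmul φ ψ) χ = B.tmul₁₂ φ (B.tmul ψ χ)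
  -- the maps `id ⊗ ε`, `ε ⊗ id`, `Δ ⊗ id`, `id ⊗ Δ` are continuous extensions
  idε_tmul : ∀ φ ψ, B.idε (B.tmul φ ψ) = B.mul φ (B.ηR (B.ε ψ))
  εid_tmul : ∀ φ ψ, B.εid (B.tmul φ ψ) = B.mul (B.ηL (B.ε φ)) ψ
  Δid_tmul : ∀ φ ψ, B.Δid (B.tmul φ ψ) = B.tmul₂₁ (B.Δ φ) ψ
  idΔ_tmul : ∀ φ ψ, B.idΔ (B.tmul φ ψ) = B.tmul₁₂ φ (B.Δ ψ)
  continuous_idε : Continuous B.idε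
  continuous_εid : Continuous B.εid
  continuous_Δid : Continuous B.Δid
  continuous_idΔ : Continuous B.idΔ
  -- the units and the counit are continuous morphisms of unital algebras
  ηL_one : B.ηL 1 = B.one
  ηL_mul : ∀ r s, B.ηL (r * s) = B.mul (B.ηL r) (B.ηL s)
  continuous_ηL : Continuous B.ηL
  ηR_one : B.ηR 1 = B.one
  ηR_mul : ∀ r s, B.ηR (r * s) = B.mul (B.ηR r) (B.ηR s)
  continuous_ηR : Continuous B.ηR
  ε_one : B.ε B.one = 1
  ε_mul : ∀ φ ψ, B.ε (B.mul φ ψ) = B.ε φ * B.ε ψ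
  continuous_ε : Continuous B.ε
  -- counit laws
  idε_Δ : ∀ φ, B.idε (B.Δ φ) = φ
  εid_Δ : ∀ φ, B.εid (B.Δ φ) = φ
  ε_ηL : ∀ r, B.ε (B.ηL r) = r
  ε_ηR : ∀ r, B.ε (B.ηR r) = r
  -- source and target laws
  Δ_ηL : ∀ r, B.Δ (B.ηL r) = B.tmul (B.ηL r) B.one
  Δ_ηR : ∀ r, B.Δ (B.ηR r) = B.tmul B.one (B.ηR r)
  -- coassociativity
  coassoc : ∀ φ, B.idΔ (B.Δ φ) = B.Δid (B.Δ φ)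
  -- the comultiplication is a continuous morphism of unital algebras
  Δ_one : B.Δ B.one = B.tmul B.one B.one
  Δ_mul : ∀ φ ψ, B.Δ (B.mul φ ψ) = B.mul₂ (B.Δ φ) (B.Δ ψ)
  continuous_Δ : Continuous B.Δ

/-- `S` is an antipode of the bialgebroid: a continuous endomorphism of the algebra `H`, exchanging
the two units, such that the maps `μ ∘ (id ⊗ S)` and `μ ∘ (S ⊗ id)` descend to continuous algebra
morphisms `idS` and `Sid` on `H ⊗̂_R H` and satisfy the antipode identities. -/
structure IsAntipode (B : BialgebroidData k R H H₂ H₃) (S : H →ₗ[k] H) (idS Sid : H₂ →ₗ[k] H) :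
    Prop where
  S_one : S B.one = B.one
  S_mul : ∀ φ ψ, S (B.mul φ ψ) = B.mul (S φ) (S ψ)
  continuous_S : Continuous S
  S_ηL : ∀ r, S (B.ηL r) = B.ηR r
  S_ηR : ∀ r, S (B.ηR r) = B.ηL r
  idS_tmul : ∀ φ ψ, idS (B.tmul φ ψ) = B.mul φ (S ψ)
  Sid_tmul : ∀ φ ψ, Sid (B.tmul φ ψ) = B.mul (S φ) ψ
  idS_mul : ∀ F G, idS (B.mul₂ F G) = B.mul (idS F) (idS G)
  Sid_mul : ∀ F G, Sid (B.mul₂ F G) = B.mul (Sid F) (Sid G)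
  continuous_idS : Continuous idS
  continuous_Sid : Continuous Sid
  idS_Δ : ∀ φ, idS (B.Δ φ) = B.ηL (B.ε φ)
  Sid_Δ : ∀ φ, Sid (B.Δ φ) = B.ηR (B.ε φ)

end BialgebroidData

variable (k R L : Type*) [CommRing k] [CommRing R] [Algebra k R] [LieRing L] [LieAlgebra k L]
  [Module R L] [LieRingModule L R] [LieRinehartRing R L] [LieRinehartAlgebra k R L]

/-- The canonical structure maps on `H = Hom_R(U, R)`, dual to those of `U`. -/
def dualData : BialgebroidData k R (Dual k R L) (Dual₂ k R L) (Dual₃ k R L) where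
  mul := dualMul k R L
  one := dualOne k R L
  ηL := etaL k R L
  ηR := etaR k R L
  Δ := dualComul k R L
  ε := dualCounit k R L
  tmul := tmul k R L
  mul₂ := dualMul₂ k R L
  tmul₂₁ := tmul₂₁
  tmul₁₂ := tmul₁₂
  idε := idCounit k R L
  εid := counitId k R L
  Δid := comulId k R L
  idΔ := idComul k R L

end LieRinehartDual

end

/-! As an algebra `U` is generated by `R` and `L`, so every element is reached from `1` by sums and
by left multiplications by `r ∈ R` and `x ∈ L` (`left_induction`). On `H` the flat connection `∇ₓ`
gives `φ(x u) = x(φ(u)) - (∇ₓφ)(u)`. A functional is therefore determined by the values at `1` of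
itself and its iterated `∇`-derivatives. Since `Δ(x u) = x · Δ(u)`, each `∇ₓ` is a derivation of the
product (`nabla_dualMul`), and an identity between products reduces to its value at `1`, where it
holds in `R`.

The same method works on `H ⊗̂ H` in the second variable. The derivation `∂ₓ` measures the failure
of `x` to pass from one factor to the other, and the slice at `v = 1` reduces an identity to one in
`H`. By associativity of `U`, `∂ₓ` kills the image of `Δ`. Multiplicativity of `Δ` is a direct
computation, because the diagonal action commutes with right multiplications (`dualMul_rmul`).

The connection makes `H` a `U`-module, and `S(φ)(u) = (u · φ)(1)`. This `S` exchanges the connection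
with right translation (`dualAct_antipode`). Both are actions in which `L` operates by derivations,
so `S` is multiplicative; exchanging them twice gives `S² = id`. Finally `μ(S ⊗ id)` carries `∂ₓ` to
`∇ₓ` (`nabla_antipodeId`). Hence `μ(S ⊗ id)Δ(φ)` is a flat element of `H` with value `φ(1)` at `1`,
which is `η_R(φ(1))`; applying `S` gives the other antipode identity.

For continuity, evaluation at a fixed `u` involves only finitely many values, ring operations and
anchor derivations. -/

noncomputable section

namespace LieRinehartDual

attribute [local instance] LieRinehartAlgebra.toLieModule

variable {k R L : Type*} [CommRing k] [CommRing R] [Algebra k R] [LieRing L] [LieAlgebra k L]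
  [Module R L] [LieRingModule L R] [LieRinehartRing R L] [LieRinehartAlgebra k R L]

/-! ### Induction on `U` by left multiplication -/

/-- `U` is spanned by the words in `R` and `L` applied to `1`. -/
theorem left_induction {P : U k R L → Prop} (one : P 1) (add : ∀ u v, P u → P v → P (u + v))
    (smul : ∀ (r : R) u, P u → P (r • u)) (ofL_mul : ∀ (x : L) u, P u → P (ofL k R L x * u))
    (u : U k R L) : P u := by
  -- The elements whose left multiplication preserves `P` form a subalgebra containing `R` and `L`,
  -- hence all of `U`; then apply `u` to `1`.
  let S : Subalgebra k (U k R L) :=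
    { carrier := {a | ∀ v, P v → P (a * v)}
      mul_mem' := fun {a b} ha hb v hv => by rw [mul_assoc]; exact ha _ (hb _ hv)
      add_mem' := fun {a b} ha hb v hv => by rw [add_mul]; exact add _ _ (ha _ hv) (hb _ hv)
      algebraMap_mem' := fun c v hv => by
        have h := smul (algebraMap k R c) v hv
        rwa [smul_def, AlgHom.commutes] at h }
  have h : u ∈ S := mem_subalgebra S (fun r v hv => smul r v hv) (fun x v hv => ofL_mul x v hv) u
  simpa using h 1 one

/-! ### Coproduct, action and counit of `U` on products -/

@[simp] lemma comul_one : comul k R L 1 = 1 ⊗ₜ 1 := by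
  change diag k R L 1 (1 ⊗ₜ 1) = _
  simp

lemma comul_mul (u v : U k R L) : comul k R L (u * v) = diag k R L u (comul k R L v) := by
  change diag k R L (u * v) (1 ⊗ₜ 1) = diag k R L u (diag k R L v (1 ⊗ₜ 1))
  simp

lemma diag_ofL (x : L) : diag k R L (ofL k R L x) = diagL k R L x := by
  simp [diag]

lemma comul_ofL_mul (x : L) (u : U k R L) :
    comul k R L (ofL k R L x * u) = diagL k R L x (comul k R L u) := by
  rw [comul_mul, diag_ofL]

@[simp] lemma act_ofR (r s : R) : act k R L (ofR k R L r) s = r * s := by simp [act]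

@[simp] lemma act_ofL (x : L) (s : R) : act k R L (ofL k R L x) s = ⁅x, s⁆ := by simp [act]

lemma counit_apply (u : U k R L) : counit k R L u = act k R L u 1 := rfl

@[simp] lemma counit_one : counit k R L 1 = 1 := by simp [counit_apply]

lemma counit_mul (u v : U k R L) :
    counit k R L (u * v) = act k R L u (counit k R L v) := by simp [counit_apply]

lemma rmul_one : rmul k R L 1 = LinearMap.id := by ext; simp

/-! ### Two families of derivations of `H` -/

/-- The flat connection `(∇ₓ φ)(u) = x(φ(u)) - φ(x u)` on `H`. -/
def nabla (x : L) : Module.End k (Dual k R L) where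
  toFun φ :=
    { toFun := fun u => ⁅x, φ u⁆ - φ (ofL k R L x * u)
      map_add' := fun u v => by simp only [map_add, lie_add, mul_add]; abel
      map_smul' := fun r u => by
        simp only [ofL_mul_smul, map_add, map_smul, smul_eq_mul,
          LieRinehartRing.leibniz_mul_right, RingHom.id_apply]
        ring }
  map_add' φ ψ := by ext u; simp; abel
  map_smul' c φ := by ext u; simp [smul_sub]

lemma nabla_apply (x : L) (φ : Dual k R L) (u : U k R L) :
    nabla x φ u = ⁅x, φ u⁆ - φ (ofL k R L x * u) := rfl

lemma apply_ofL_mul (φ : Dual k R L) (x : L) (u : U k R L) :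
    φ (ofL k R L x * u) = ⁅x, φ u⁆ - nabla x φ u := by rw [nabla_apply, sub_sub_cancel]

/-- Dual to `Δ(x u) = x · Δ(u)`: on each `a ⊗ b` the diagonal action and the Leibniz rule of `x` on
`R` match term by term. -/
lemma nabla_dualMul (x : L) (φ ψ : Dual k R L) :
    nabla x (dualMul k R L φ ψ) = dualMul k R L (nabla x φ) ψ + dualMul k R L φ (nabla x ψ) := by
  ext u
  rw [nabla_apply, LinearMap.add_apply]
  simp only [dualMul_apply, comul_ofL_mul]
  induction comul k R L u with
  | zero => simp
  | add a b ha hb => simp only [map_add, lie_add, add_sub_add_comm, ha, hb]; abel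
  | tmul a b =>
    simp only [diagL_tmul, map_add, TensorProduct.map_tmul, LinearMap.mul'_apply, nabla_apply,
      LieRinehartRing.leibniz_mul_right, smul_eq_mul]
    ring

/-- The diagonal action commutes with right multiplications, so `u · (a ⊗ b)` is `Δ(u)` multiplied
on the right by `a ⊗ b`. -/
lemma dualMul_rmul (φ ψ : Dual k R L) (a b u : U k R L) :
    dualMul k R L (φ ∘ₗ rmul k R L a) (ψ ∘ₗ rmul k R L b) u =
      LinearMap.mul' R R (TensorProduct.map φ ψ (diag k R L u (a ⊗ₜ b))) := by
  have h : a ⊗ₜ[R] b = TensorProduct.map (rmul k R L a) (rmul k R L b) (1 ⊗ₜ 1) := by simp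
  rw [h, diag_map_rmul, dualMul_apply, TensorProduct.map_comp]
  rfl

/-- Right translation by `x` is a derivation because `Δ(x) = x ⊗ 1 + 1 ⊗ x`. This is the second
family, which `S` later exchanges with `∇ₓ`. -/
lemma dualMul_comp_rmul_ofL (φ ψ : Dual k R L) (x : L) :
    dualMul k R L φ ψ ∘ₗ rmul k R L (ofL k R L x) =
      dualMul k R L (φ ∘ₗ rmul k R L (ofL k R L x)) ψ +
        dualMul k R L φ (ψ ∘ₗ rmul k R L (ofL k R L x)) := by
  ext u
  have h1 := dualMul_rmul φ ψ (ofL k R L x) 1 u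
  have h2 := dualMul_rmul φ ψ 1 (ofL k R L x) u
  rw [rmul_one, LinearMap.comp_id] at h1 h2
  rw [LinearMap.add_apply, h1, h2, LinearMap.comp_apply, rmul_apply, dualMul_apply, comul_mul,
    ← mul_one (ofL k R L x), comul_ofL_mul, comul_one, diagL_tmul]
  simp

/-! ### `H` is a commutative algebra -/

@[simp] lemma dualMul_apply_one (φ ψ : Dual k R L) : dualMul k R L φ ψ 1 = φ 1 * ψ 1 := by
  simp [dualMul_apply]

/-- The model of the later inductions: both sides agree at `1` and obey the same Leibniz rule. The
functionals must stay general, since the step for `x u` replaces one of them by its `∇ₓ`. -/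
lemma dualMul_comm (φ ψ : Dual k R L) : dualMul k R L φ ψ = dualMul k R L ψ φ := by
  ext u
  induction u using left_induction generalizing φ ψ with
  | one => simp [mul_comm]
  | add u v hu hv => simp only [map_add, hu, hv]
  | smul r u hu => simp only [map_smul, hu]
  | ofL_mul x u hu =>
    simp only [apply_ofL_mul, nabla_dualMul, LinearMap.add_apply]
    rw [hu φ ψ, hu (nabla x φ), hu φ, add_comm]

lemma dualMul_assoc (φ ψ χ : Dual k R L) :
    dualMul k R L (dualMul k R L φ ψ) χ = dualMul k R L φ (dualMul k R L ψ χ) := by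
  ext u
  induction u using left_induction generalizing φ ψ χ with
  | one => simp [mul_assoc]
  | add u v hu hv => simp only [map_add, hu, hv]
  | smul r u hu => simp only [map_smul, hu]
  | ofL_mul x u hu =>
    simp only [apply_ofL_mul, nabla_dualMul, LinearMap.add_apply, map_add, hu]
    abel

@[simp] lemma nabla_dualOne (x : L) : nabla x (dualOne k R L) = 0 := by
  ext u
  simp [nabla_apply, dualOne, counit_mul]

lemma one_dualMul (φ : Dual k R L) : dualMul k R L (dualOne k R L) φ = φ := by
  ext u
  induction u using left_induction generalizing φ with
  | one => simp [dualOne]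
  | add u v hu hv => simp only [map_add, hu, hv]
  | smul r u hu => simp only [map_smul, hu]
  | ofL_mul x u hu =>
    simp only [apply_ofL_mul, nabla_dualMul, nabla_dualOne, map_zero, LinearMap.zero_apply,
      zero_add, hu]

/-! ### The two units -/

lemma etaL_apply (r : R) (u : U k R L) : etaL k R L r u = r * counit k R L u := rfl

lemma etaR_apply (r : R) (u : U k R L) : etaR k R L r u = act k R L u r := rfl

lemma etaL_dualMul (r : R) (φ : Dual k R L) : dualMul k R L (etaL k R L r) φ = r • φ := by
  conv_rhs => rw [← one_dualMul φ]
  ext u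
  change dualMul k R L (r • dualOne k R L) φ u = r • dualMul k R L (dualOne k R L) φ u
  rw [dualMul_apply, dualMul_apply, TensorProduct.map_smul_left]
  simp

lemma etaR_eq (r : R) : etaR k R L r = dualOne k R L ∘ₗ rmul k R L (ofR k R L r) := by
  ext u
  simp [etaR_apply, dualOne, counit_apply]

/-- Follows from `Δ(u r) = Δ(u)(r ⊗ 1)` and the unit law, as `η_R(r)` is the right translate of the
unit by `r`. -/
lemma etaR_dualMul (r : R) (φ : Dual k R L) :
    dualMul k R L (etaR k R L r) φ = φ ∘ₗ rmul k R L (ofR k R L r) := by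
  ext u
  rw [etaR_eq, dualMul_rmul_left, one_dualMul]
  rfl

lemma etaL_mul (r s : R) :
    etaL k R L (r * s) = dualMul k R L (etaL k R L r) (etaL k R L s) := by
  ext u
  simp [etaL_dualMul, etaL_apply, mul_assoc]

lemma etaR_mul (r s : R) :
    etaR k R L (r * s) = dualMul k R L (etaR k R L r) (etaR k R L s) := by
  ext u
  rw [etaR_dualMul]
  simp [etaR_apply]

/-! ### The tensor product of functionals -/

lemma tmul_apply (φ ψ : Dual k R L) (u v : U k R L) :
    (tmul k R L φ ψ).1 u v = φ (u * ofR k R L (ψ v)) := rfl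

/-- Turns the composite `φ(u ψ(v))` into a product in `H`, so that algebraic and topological facts
about `φ ⊗ ψ` follow from those about products and `η_R`. -/
lemma slice_tmul (φ ψ : Dual k R L) (v : U k R L) :
    slice (tmul k R L φ ψ) v = dualMul k R L (etaR k R L (ψ v)) φ := by
  ext u
  rw [etaR_dualMul]
  rfl

/-! ### Derivations of the completed tensor square -/

lemma slice_injective {F G : Dual₂ k R L} (h : ∀ v, slice F v = slice G v) : F = G := by
  ext u v
  exact DFunLike.congr_fun (h v) u

lemma slice_dualMul₂ (F G : Dual₂ k R L) (v : U k R L) :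
    slice (dualMul₂ k R L F G) v = sliceMul F G (comul k R L v) := rfl

lemma apply_ofL_mul_ofR (F : Dual₂ k R L) (x : L) (r : R) (u v : U k R L) :
    F.1 u (ofL k R L x * r • v) =
      F.1 (u * ofR k R L ⁅x, r⁆) v + F.1 (u * ofR k R L r) (ofL k R L x * v) := by
  rw [ofL_mul_smul, map_add, F.2.2, F.2.2]

/-- The derivation `(∂ₓ F)(u, v) = F(u x, v) - F(u, x v)` of `H ⊗̂_R H`. -/
def partialDeriv (x : L) (F : Dual₂ k R L) : Dual₂ k R L :=
  ⟨LinearMap.mk₂ k (fun u v => F.1 (u * ofL k R L x) v - F.1 u (ofL k R L x * v))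
      (fun u u' v => by simp only [add_mul, map_add, LinearMap.add_apply]; abel)
      (fun c u v => by simp [smul_sub])
      (fun u v v' => by simp only [mul_add, map_add]; abel)
      (fun c u v => by simp [smul_sub]),
    fun r u v => by simp [smul_mul_assoc, F.2.1, mul_sub],
    -- Balancedness: moving `r` across the tensor sign gives a term `F(u x(r), v)`, and `x r = r x +
    -- x(r)` in the first argument gives the one that cancels it.
    fun u r v => by
      simp only [LinearMap.mk₂_apply, apply_ofL_mul_ofR, ← F.2.2, ofR_lie, mul_sub, map_sub,
        LinearMap.sub_apply, mul_assoc]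
      abel⟩

/-- The recursion in the second variable, playing for `H ⊗̂ H` the role of `apply_ofL_mul`, with
right translation in place of the anchor. -/
lemma slice_ofL_mul (x : L) (F : Dual₂ k R L) (v : U k R L) :
    slice F (ofL k R L x * v) =
      slice F v ∘ₗ rmul k R L (ofL k R L x) - slice (partialDeriv x F) v := by
  ext u
  exact (sub_sub_cancel (F.1 (u * ofL k R L x) v) (F.1 u (ofL k R L x * v))).symm

lemma sliceMul_diagL (F G : Dual₂ k R L) (x : L) (t : U k R L ⊗[R] U k R L) :
    sliceMul F G (diagL k R L x t) = sliceMul F G t ∘ₗ rmul k R L (ofL k R L x) -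
      (sliceMul (partialDeriv x F) G t + sliceMul F (partialDeriv x G) t) := by
  induction t with
  | zero => simp
  | add a b ha hb => simp only [map_add, ha, hb, LinearMap.add_comp]; abel
  | tmul a b =>
    simp only [diagL_tmul, map_add, sliceMul_tmul, slice_ofL_mul, map_sub, LinearMap.sub_apply,
      dualMul_comp_rmul_ofL]
    abel

lemma partialDeriv_dualMul₂ (x : L) (F G : Dual₂ k R L) :
    partialDeriv x (dualMul₂ k R L F G) =
      dualMul₂ k R L (partialDeriv x F) G + dualMul₂ k R L F (partialDeriv x G) := by
  refine slice_injective fun v => ?_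
  -- The slice of `FG` at `x v` is expanded twice, by the recursion for `FG` and by the diagonal
  -- action on `Δ(v)`. The translation terms agree, so the derivative terms do.
  have h := slice_ofL_mul x (dualMul₂ k R L F G) v
  rw [slice_dualMul₂, comul_ofL_mul, sliceMul_diagL] at h
  exact (sub_right_inj.1 h).symm

lemma slice_dualMul₂_one (F G : Dual₂ k R L) :
    slice (dualMul₂ k R L F G) 1 = dualMul k R L (slice F 1) (slice G 1) := by
  rw [slice_dualMul₂, comul_one, sliceMul_tmul]

/-! ### `H ⊗̂_R H` is a commutative algebra -/

lemma dualMul₂_comm (F G : Dual₂ k R L) : dualMul₂ k R L F G = dualMul₂ k R L G F := by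
  refine slice_injective fun v => ?_
  induction v using left_induction generalizing F G with
  | one => rw [slice_dualMul₂_one, slice_dualMul₂_one, dualMul_comm]
  | add u v hu hv => simp only [map_add, hu, hv]
  | smul r u hu => simp only [slice_smul, hu F G]
  | ofL_mul x u hu =>
    simp only [slice_ofL_mul, partialDeriv_dualMul₂, slice_add]
    rw [hu F G, hu (partialDeriv x F), hu F, add_comm]

lemma dualMul₂_assoc (F G K : Dual₂ k R L) :
    dualMul₂ k R L (dualMul₂ k R L F G) K = dualMul₂ k R L F (dualMul₂ k R L G K) := by
  refine slice_injective fun v => ?_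
  induction v using left_induction generalizing F G K with
  | one => simp only [slice_dualMul₂_one, dualMul_assoc]
  | add u v hu hv => simp only [map_add, hu, hv]
  | smul r u hu => simp only [slice_smul, hu]
  | ofL_mul x u hu =>
    simp only [slice_ofL_mul, partialDeriv_dualMul₂, slice_add, map_add, LinearMap.add_apply, hu]
    abel

/-- Slice by slice this is multiplicativity of `η_R` together with commutativity of `H`. -/
lemma tmul_dualMul₂ (φ ψ φ' ψ' : Dual k R L) :
    dualMul₂ k R L (tmul k R L φ ψ) (tmul k R L φ' ψ') =
      tmul k R L (dualMul k R L φ φ') (dualMul k R L ψ ψ') := by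
  refine slice_injective fun v => ?_
  rw [slice_dualMul₂, slice_tmul, dualMul_apply]
  induction comul k R L v with
  | zero => simp
  | add a b ha hb => simp only [map_add, ha, hb, LinearMap.add_apply]
  | tmul a b =>
    simp only [sliceMul_tmul, slice_tmul, TensorProduct.map_tmul, LinearMap.mul'_apply, etaR_mul,
      dualMul_assoc]
    rw [← dualMul_assoc φ, dualMul_comm φ, dualMul_assoc]

/-! ### The coproduct of `H` is multiplicative -/

lemma dualComul_apply (φ : Dual k R L) (u v : U k R L) :
    (dualComul k R L φ).1 u v = φ (u * v) := rfl

lemma slice_dualComul (φ : Dual k R L) (v : U k R L) :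
    slice (dualComul k R L φ) v = φ ∘ₗ rmul k R L v := rfl

lemma dualComul_one :
    dualComul k R L (dualOne k R L) = tmul k R L (dualOne k R L) (dualOne k R L) := by
  ext u v
  rw [dualComul_apply, tmul_apply]
  simp [dualOne, counit_apply]

/-- The slices of `Δ(φ)` are right translates of `φ`, so both sides evaluate `φ` and `ψ` on `u ·
Δ(v) = Δ(u v)`. -/
lemma dualComul_mul (φ ψ : Dual k R L) : dualComul k R L (dualMul k R L φ ψ) =
    dualMul₂ k R L (dualComul k R L φ) (dualComul k R L ψ) := by
  refine slice_injective fun v => LinearMap.ext fun u => ?_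
  rw [slice_dualMul₂, slice_dualComul, LinearMap.comp_apply, rmul_apply, dualMul_apply, comul_mul]
  induction comul k R L v with
  | zero => simp
  | add a b ha hb => simp only [map_add, ha, hb, LinearMap.add_apply]
  | tmul a b => rw [sliceMul_tmul, slice_dualComul, slice_dualComul, dualMul_rmul]

@[simp] lemma partialDeriv_dualComul (x : L) (φ : Dual k R L) :
    partialDeriv x (dualComul k R L φ) = 0 := by
  ext u v
  exact sub_eq_zero.2 (congrArg φ (mul_assoc u _ v))

lemma one_dualMul₂ (F : Dual₂ k R L) :
    dualMul₂ k R L (tmul k R L (dualOne k R L) (dualOne k R L)) F = F := by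
  -- Written as `Δ(1)`, the element `1 ⊗ 1` is killed by every `∂ₓ`.
  rw [← dualComul_one]
  refine slice_injective fun v => ?_
  induction v using left_induction generalizing F with
  | one => rw [slice_dualMul₂_one, slice_dualComul, rmul_one, LinearMap.comp_id, one_dualMul]
  | add u v hu hv => simp only [map_add, hu]; rw [hv]
  | smul r u hu => simp only [slice_smul, hu]
  | ofL_mul x u hu =>
    simp only [slice_ofL_mul, partialDeriv_dualMul₂, partialDeriv_dualComul, map_zero,
      LinearMap.zero_apply, zero_add, hu]

/-! ### The antipode -/

variable (k R L) in
/-- The action of `U` on `H` given by the flat connection `∇`. -/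
def dualAct : U k R L →ₐ[k] Module.End k (Dual k R L) :=
  lift (A := Module.End k (Dual k R L)) (Algebra.lsmul k k (Dual k R L))
    { toFun := nabla
      map_add' := fun x y => by ext φ u; simp [nabla_apply, add_mul]; abel
      map_smul' := fun c x => by ext φ u; simp [nabla_apply, smul_sub] }
    -- Flatness of the connection: the bracket of `L` goes to the commutator.
    (fun x y => by
      ext φ u
      simp [nabla_apply, ofL_lie, sub_mul, mul_assoc]
      abel)
    (fun x r => by
      ext φ u
      simp [nabla_apply, mul_sub])
    (fun r x => by
      ext φ u
      simp [nabla_apply, ofL_smul, ← smul_def, mul_sub, smul_mul_assoc])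

@[simp] lemma dualAct_ofR (r : R) (φ : Dual k R L) :
    dualAct k R L (ofR k R L r) φ = r • φ := by simp [dualAct]

@[simp] lemma dualAct_ofL (x : L) (φ : Dual k R L) :
    dualAct k R L (ofL k R L x) φ = nabla x φ := by simp [dualAct]

lemma dualAct_smul (r : R) (u : U k R L) (φ : Dual k R L) :
    dualAct k R L (r • u) φ = r • dualAct k R L u φ := by
  rw [smul_def, map_mul, Module.End.mul_apply, dualAct_ofR]

lemma dualAct_ofL_mul (x : L) (u : U k R L) (φ : Dual k R L) :
    dualAct k R L (ofL k R L x * u) φ = nabla x (dualAct k R L u φ) := by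
  rw [map_mul, Module.End.mul_apply, dualAct_ofL]

/-- The connection only involves left multiplication on `U`, which commutes with right
multiplication. -/
lemma dualAct_comp_rmul (u a : U k R L) (φ : Dual k R L) :
    dualAct k R L u (φ ∘ₗ rmul k R L a) = dualAct k R L u φ ∘ₗ rmul k R L a := by
  induction u using left_induction with
  | one => simp
  | add u v hu hv => simp only [map_add, LinearMap.add_apply, hu, hv, LinearMap.add_comp]
  | smul r u hu => rw [dualAct_smul, dualAct_smul, hu, LinearMap.smul_comp]
  | ofL_mul x u hu =>
    rw [dualAct_ofL_mul, dualAct_ofL_mul, hu]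
    ext v
    simp [nabla_apply, mul_assoc]

variable (k R L) in
/-- The antipode `S(φ)(u) = (u · φ)(1)` of `H`. -/
def antipode : Dual k R L →ₗ[k] Dual k R L where
  toFun φ :=
    { toFun := fun u => dualAct k R L u φ 1
      map_add' := fun u v => by simp
      map_smul' := fun r u => by simp [dualAct_smul] }
  map_add' φ ψ := by ext u; simp
  map_smul' c φ := by ext u; simp

lemma antipode_apply (φ : Dual k R L) (u : U k R L) :
    antipode k R L φ u = dualAct k R L u φ 1 := rfl

@[simp] lemma antipode_apply_one (φ : Dual k R L) : antipode k R L φ 1 = φ 1 := by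
  simp [antipode_apply]

/-- Expanding `S(φ)(x u) = (x · (u · φ))(1)` leaves `(u · φ)(x)`, which is the right translate by
`x` evaluated at `1`. -/
lemma nabla_antipode (x : L) (φ : Dual k R L) :
    nabla x (antipode k R L φ) = antipode k R L (φ ∘ₗ rmul k R L (ofL k R L x)) := by
  ext u
  rw [nabla_apply, antipode_apply, antipode_apply, antipode_apply, dualAct_ofL_mul,
    dualAct_comp_rmul, nabla_apply, sub_sub_cancel]
  simp

lemma smul_antipode (r : R) (φ : Dual k R L) :
    r • antipode k R L φ = antipode k R L (φ ∘ₗ rmul k R L (ofR k R L r)) := by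
  ext u
  rw [LinearMap.smul_apply, antipode_apply, antipode_apply, dualAct_comp_rmul, ← map_smul]
  simp [smul_def]

/-- `S` carries right translation to the connection action; at `1` this gives `S² = id`. -/
lemma dualAct_antipode (u : U k R L) (φ : Dual k R L) :
    dualAct k R L u (antipode k R L φ) = antipode k R L (φ ∘ₗ rmul k R L u) := by
  induction u using left_induction with
  | one => simp [rmul_one]
  | add u v hu hv =>
    have h : rmul k R L (u + v) = rmul k R L u + rmul k R L v := by ext; simp [mul_add]
    rw [map_add, LinearMap.add_apply, hu, hv, h, LinearMap.comp_add, map_add]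
  | smul r u hu =>
    rw [dualAct_smul, hu, smul_antipode]
    congr 1
    ext v
    simp [smul_def, mul_assoc]
  | ofL_mul x u hu =>
    rw [dualAct_ofL_mul, hu, nabla_antipode]
    congr 1
    ext v
    simp [mul_assoc]

lemma antipode_antipode (φ : Dual k R L) : antipode k R L (antipode k R L φ) = φ := by
  ext u
  rw [antipode_apply, dualAct_antipode]
  simp

/-- `S` sends right translation by `x` to `∇ₓ`, both are derivations, and `S` does not change the
value at `1`. -/
lemma antipode_dualMul (φ ψ : Dual k R L) : antipode k R L (dualMul k R L φ ψ) =
    dualMul k R L (antipode k R L φ) (antipode k R L ψ) := by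
  ext u
  induction u using left_induction generalizing φ ψ with
  | one => simp
  | add u v hu hv => simp only [map_add, hu, hv]
  | smul r u hu => simp only [map_smul, hu]
  | ofL_mul x u hu =>
    simp only [apply_ofL_mul, nabla_dualMul, LinearMap.add_apply, nabla_antipode,
      dualMul_comp_rmul_ofL, map_add, hu]

lemma nabla_etaL (x : L) (r : R) : nabla x (etaL k R L r) = etaL k R L ⁅x, r⁆ := by
  ext u
  simp [nabla_apply, etaL_apply, counit_mul]

lemma antipode_etaL (r : R) : antipode k R L (etaL k R L r) = etaR k R L r := by
  ext u
  -- `η_L` is `U`-equivariant, since `ε(x u) = x(ε(u))`.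
  have key : dualAct k R L u (etaL k R L r) = etaL k R L (act k R L u r) := by
    induction u using left_induction with
    | one => simp
    | add u v hu hv => simp only [map_add, LinearMap.add_apply, hu, hv]
    | smul s u hu =>
      rw [dualAct_smul, hu, smul_def, map_mul, Module.End.mul_apply, act_ofR]
      ext v
      simp [etaL_apply, mul_assoc]
    | ofL_mul x u hu => rw [dualAct_ofL_mul, hu, nabla_etaL, map_mul, Module.End.mul_apply, act_ofL]
  rw [antipode_apply, key]
  simp [etaL_apply, etaR_apply]

lemma antipode_etaR (r : R) : antipode k R L (etaR k R L r) = etaL k R L r := by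
  rw [← antipode_etaL, antipode_antipode]

lemma antipode_one : antipode k R L (dualOne k R L) = dualOne k R L := by
  have h := antipode_etaL (k := k) (L := L) (1 : R)
  have h1 : etaL k R L 1 = dualOne k R L := one_smul R _
  have h2 : etaR k R L 1 = dualOne k R L := rfl
  rwa [h1, h2] at h

/-- The map `a ⊗ b ↦ S(F(-, b))(a)` from `U ⊗_R U` to `R`. -/
def antipodeSlice (F : Dual₂ k R L) : U k R L ⊗[R] U k R L →ₗ[R] R :=
  TensorProduct.lift (LinearMap.mk₂ R (fun a b => antipode k R L (slice F b) a)
    (fun a a' b => by simp)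
    (fun r a b => by simp)
    (fun a b b' => by simp)
    -- Well defined over `R`: scaling `b` right-translates the slice by `r`, and `S` turns that into
    -- left multiplication by `r`.
    (fun r a b => by rw [slice_smul, ← smul_antipode, LinearMap.smul_apply]))

@[simp] lemma antipodeSlice_tmul (F : Dual₂ k R L) (a b : U k R L) :
    antipodeSlice F (a ⊗ₜ b) = antipode k R L (slice F b) a := rfl

variable (k R L) in
/-- The map `μ(S ⊗ id) : H ⊗̂_R H → H`, `F ↦ (u ↦ ∑ S(F(-, u₂))(u₁))`. -/
def antipodeId : Dual₂ k R L →ₗ[k] Dual k R L where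
  toFun F := antipodeSlice F ∘ₗ comul k R L
  map_add' F G := by
    rw [← LinearMap.add_comp]
    congr 1
    ext a b
    simp [slice_add]
  map_smul' c F := by
    rw [RingHom.id_apply, ← LinearMap.smul_comp]
    congr 1
    ext a b
    simp [slice_smul']

lemma antipodeId_apply (F : Dual₂ k R L) (u : U k R L) :
    antipodeId k R L F u = antipodeSlice F (comul k R L u) := rfl

@[simp] lemma antipodeId_apply_one (F : Dual₂ k R L) : antipodeId k R L F 1 = F.1 1 1 := by
  simp [antipodeId_apply]

/-- On `a ⊗ b`, the term from `x a` produces `∇ₓ S(F(-, b))`. The translation part of the slice at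
`x b` cancels it by `nabla_antipode`, leaving only `∂ₓF`. -/
lemma nabla_antipodeId (x : L) (F : Dual₂ k R L) :
    nabla x (antipodeId k R L F) = antipodeId k R L (partialDeriv x F) := by
  ext u
  rw [nabla_apply]
  simp only [antipodeId_apply, comul_ofL_mul]
  induction comul k R L u with
  | zero => simp
  | add a b ha hb => simp only [map_add, lie_add, add_sub_add_comm, ha, hb]
  | tmul a b =>
    simp only [diagL_tmul, map_add, antipodeSlice_tmul, slice_ofL_mul, map_sub,
      apply_ofL_mul, nabla_antipode, LinearMap.sub_apply]
    abel

lemma antipodeId_dualMul₂ (F G : Dual₂ k R L) : antipodeId k R L (dualMul₂ k R L F G) =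
    dualMul k R L (antipodeId k R L F) (antipodeId k R L G) := by
  ext u
  induction u using left_induction generalizing F G with
  | one =>
    rw [antipodeId_apply_one, dualMul_apply_one, antipodeId_apply_one, antipodeId_apply_one]
    exact (DFunLike.congr_fun (slice_dualMul₂_one F G) 1).trans (dualMul_apply_one _ _)
  | add u v hu hv => simp only [map_add, hu, hv]
  | smul r u hu => simp only [map_smul, hu]
  | ofL_mul x u hu =>
    simp only [apply_ofL_mul, nabla_dualMul, LinearMap.add_apply, nabla_antipodeId,
      partialDeriv_dualMul₂, map_add, hu]

lemma antipodeId_tmul (φ ψ : Dual k R L) :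
    antipodeId k R L (tmul k R L φ ψ) = dualMul k R L (antipode k R L φ) ψ := by
  ext u
  rw [antipodeId_apply, dualMul_apply]
  induction comul k R L u with
  | zero => simp
  | add a b ha hb => simp only [map_add, ha, hb]
  | tmul a b =>
    rw [antipodeSlice_tmul, slice_tmul, antipode_dualMul, antipode_etaR, etaL_dualMul]
    simp [mul_comm]

/-- `∂ₓ` kills `Δ(φ)`, so the left side is flat. So is `η_R(φ(1))`, and the two agree at `1`. -/
lemma antipodeId_dualComul (φ : Dual k R L) :
    antipodeId k R L (dualComul k R L φ) = etaR k R L (φ 1) := by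
  ext u
  induction u using left_induction with
  | one => simp [etaR_apply, dualComul_apply]
  | add u v hu hv => simp only [map_add, hu, hv]
  | smul r u hu => simp only [map_smul, hu]
  | ofL_mul x u hu =>
    rw [apply_ofL_mul, nabla_antipodeId, partialDeriv_dualComul, hu]
    simp [etaR_apply]

/-! ### Continuity -/

section Topology

variable [TopologicalSpace R]

lemma continuous_dual_iff {X : Type*} [TopologicalSpace X] {f : X → Dual k R L} :
    Continuous f ↔ ∀ u, Continuous fun a => f a u :=
  continuous_induced_rng.trans continuous_pi_iff

lemma continuous_dual₂_iff {X : Type*} [TopologicalSpace X] {f : X → Dual₂ k R L} :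
    Continuous f ↔ ∀ u v, Continuous fun a => (f a).1 u v :=
  (continuous_induced_rng.trans continuous_pi_iff).trans Prod.forall

lemma continuous_dual₃ {X : Type*} [TopologicalSpace X] {f : X → Dual₃ k R L}
    (h : ∀ u v w, Continuous fun a => (f a).1 u v w) : Continuous f :=
  continuous_induced_rng.2 (continuous_pi fun p => h p.1 p.2.1 p.2.2)

lemma continuous_eval (u : U k R L) : Continuous fun φ : Dual k R L => φ u :=
  continuous_dual_iff.1 continuous_id u

lemma continuous_eval₂ (u v : U k R L) : Continuous fun F : Dual₂ k R L => F.1 u v :=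
  continuous_dual₂_iff.1 continuous_id u v

lemma continuous_slice (v : U k R L) : Continuous fun F : Dual₂ k R L => slice F v :=
  continuous_dual_iff.2 fun u => continuous_eval₂ u v

variable [IsTopologicalRing R]

/-- For fixed `u`, `Δ(u)` is a fixed finite sum of pure tensors, so each value of the product is a
polynomial in finitely many values of the factors. -/
lemma continuous_dualMul {X : Type*} [TopologicalSpace X] {f g : X → Dual k R L}
    (hf : Continuous f) (hg : Continuous g) :
    Continuous fun a => dualMul k R L (f a) (g a) := by
  refine continuous_dual_iff.2 fun u => ?_
  simp only [dualMul_apply]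
  induction comul k R L u with
  | zero => simpa using continuous_const
  | add a b ha hb =>
    simp only [map_add]
    exact ha.add hb
  | tmul a b =>
    simp only [TensorProduct.map_tmul, LinearMap.mul'_apply]
    exact (continuous_dual_iff.1 hf a).mul (continuous_dual_iff.1 hg b)

lemma continuous_dualMul₂ :
    Continuous fun p : Dual₂ k R L × Dual₂ k R L => dualMul₂ k R L p.1 p.2 := by
  refine continuous_dual₂_iff.2 fun u v => ?_
  change Continuous fun p : Dual₂ k R L × Dual₂ k R L => sliceMul p.1 p.2 (comul k R L v) u
  induction comul k R L v with
  | zero => simpa using continuous_const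
  | add a b ha hb =>
    simp only [map_add, LinearMap.add_apply]
    exact ha.add hb
  | tmul a b =>
    simp only [sliceMul_tmul]
    exact continuous_dual_iff.1 (continuous_dualMul
      (f := fun p : Dual₂ k R L × Dual₂ k R L => slice p.1 a) (g := fun p => slice p.2 b)
      ((continuous_slice a).comp continuous_fst) ((continuous_slice b).comp continuous_snd)) u

lemma continuous_act (hcont : ∀ x : L, Continuous fun r : R => ⁅x, r⁆) (u : U k R L) :
    Continuous fun r => act k R L u r := by
  induction u using left_induction with
  | one =>
    simp only [map_one, Module.End.one_apply]
    exact continuous_id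
  | add u v hu hv =>
    simp only [map_add, LinearMap.add_apply]
    exact hu.add hv
  | smul r u hu =>
    simp only [smul_def, map_mul, Module.End.mul_apply, act_ofR]
    exact continuous_const.mul hu
  | ofL_mul x u hu =>
    simp only [map_mul, Module.End.mul_apply, act_ofL]
    exact (hcont x).comp hu

lemma continuous_etaR (hcont : ∀ x : L, Continuous fun r : R => ⁅x, r⁆) :
    Continuous fun r => etaR k R L r :=
  continuous_dual_iff.2 fun u => continuous_act hcont u

/-- In `φ(u ψ(v))` the point of evaluation moves with `ψ`, so pointwise convergence does not apply
directly. As the product `η_R(ψ(v)) φ` it reduces to continuity of `η_R`, hence of the anchor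
derivations. -/
lemma continuous_tmul (hcont : ∀ x : L, Continuous fun r : R => ⁅x, r⁆) :
    Continuous fun p : Dual k R L × Dual k R L => tmul k R L p.1 p.2 := by
  refine continuous_dual₂_iff.2 fun u v => ?_
  simp only [← slice_apply, slice_tmul]
  exact continuous_dual_iff.1 (continuous_dualMul
    (f := fun p : Dual k R L × Dual k R L => etaR k R L (p.2 v)) (g := fun p => p.1)
    ((continuous_etaR hcont).comp ((continuous_eval v).comp continuous_snd)) continuous_fst) u

lemma continuous_dualAct (hcont : ∀ x : L, Continuous fun r : R => ⁅x, r⁆) (u : U k R L) :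
    Continuous fun φ => dualAct k R L u φ := by
  refine continuous_dual_iff.2 fun v => ?_
  -- The point `v` varies because `∇ₓ` also evaluates at `x v`.
  induction u using left_induction generalizing v with
  | one => simpa using continuous_eval v
  | add u u' hu hu' =>
    simp only [map_add, LinearMap.add_apply]
    exact (hu v).add (hu' v)
  | smul r u hu =>
    simp only [dualAct_smul, LinearMap.smul_apply, smul_eq_mul]
    exact continuous_const.mul (hu v)
  | ofL_mul x u hu =>
    simp only [dualAct_ofL_mul, nabla_apply]
    exact ((hcont x).comp (hu v)).sub (hu (ofL k R L x * v))

lemma continuous_antipode (hcont : ∀ x : L, Continuous fun r : R => ⁅x, r⁆) :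
    Continuous fun φ => antipode k R L φ :=
  continuous_dual_iff.2 fun u => continuous_dual_iff.1 (continuous_dualAct hcont u) 1

lemma continuous_antipodeId (hcont : ∀ x : L, Continuous fun r : R => ⁅x, r⁆) :
    Continuous fun F => antipodeId k R L F := by
  refine continuous_dual_iff.2 fun u => ?_
  simp only [antipodeId_apply]
  induction comul k R L u with
  | zero => simpa using continuous_const
  | add a b ha hb =>
    simp only [map_add]
    exact ha.add hb
  | tmul a b =>
    exact continuous_dual_iff.1 ((continuous_antipode hcont).comp (continuous_slice b)) a

end Topology

/-! ### Verification of the bialgebroid and antipode axioms -/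

variable (k R L) in
theorem dualData_isBialgebroid [TopologicalSpace R] [IsTopologicalRing R]
    (hcont : ∀ x : L, Continuous fun r : R => ⁅x, r⁆) : (dualData k R L).IsBialgebroid where
  mul_comm := dualMul_comm
  mul_assoc := dualMul_assoc
  one_mul := one_dualMul
  continuous_add := continuous_dual_iff.2 fun u =>
    ((continuous_eval u).comp continuous_fst).add ((continuous_eval u).comp continuous_snd)
  continuous_mul := continuous_dualMul continuous_fst continuous_snd
  mul₂_comm := dualMul₂_comm
  mul₂_assoc := dualMul₂_assoc
  one_mul₂ := one_dualMul₂
  continuous_add₂ := continuous_dual₂_iff.2 fun u v =>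
    ((continuous_eval₂ u v).comp continuous_fst).add ((continuous_eval₂ u v).comp continuous_snd)
  continuous_mul₂ := continuous_dualMul₂
  tmul_balanced φ r ψ := by
    ext u v
    change dualMul k R L φ (etaR k R L r) (u * ofR k R L (ψ v)) =
      φ (u * ofR k R L (dualMul k R L (etaL k R L r) ψ v))
    rw [dualMul_comm, etaR_dualMul, etaL_dualMul]
    simp [mul_assoc, ← map_mul, mul_comm]
  tmul_mul := tmul_dualMul₂
  continuous_tmul := continuous_tmul hcont
  tmul_assoc φ ψ χ := rfl
  idε_tmul φ ψ := by
    change _ = dualMul k R L φ (etaR k R L (ψ 1))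
    rw [dualMul_comm, ← slice_tmul]
    rfl
  εid_tmul φ ψ := by
    change _ = dualMul k R L (etaL k R L (φ 1)) ψ
    rw [etaL_dualMul]
    ext v
    change φ (1 * ofR k R L (ψ v)) = φ 1 * ψ v
    rw [one_mul, ← mul_one (ofR k R L (ψ v)), ← smul_def, map_smul, smul_eq_mul, mul_comm]
  Δid_tmul φ ψ := by
    ext u v w
    exact congrArg φ (mul_assoc u v _)
  idΔ_tmul φ ψ := rfl
  continuous_idε := continuous_slice 1
  continuous_εid := continuous_dual_iff.2 fun v => continuous_eval₂ 1 v
  continuous_Δid := continuous_dual₃ fun u v w => continuous_eval₂ (u * v) w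
  continuous_idΔ := continuous_dual₃ fun u v w => continuous_eval₂ u (v * w)
  ηL_one := one_smul R _
  ηL_mul := etaL_mul
  continuous_ηL := continuous_dual_iff.2 fun u => continuous_id.mul continuous_const
  ηR_one := rfl
  ηR_mul := etaR_mul
  continuous_ηR := continuous_etaR hcont
  ε_one := counit_one
  ε_mul := dualMul_apply_one
  continuous_ε := continuous_eval 1
  idε_Δ φ := by
    ext u
    exact congrArg φ (mul_one u)
  εid_Δ φ := by
    ext u
    exact congrArg φ (one_mul u)
  ε_ηL r := (congrArg (r * ·) counit_one).trans (mul_one r)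
  ε_ηR r := by
    change act k R L 1 r = r
    simp
  Δ_ηL r := by
    ext u v
    change r * counit k R L (u * v) = r * counit k R L (u * ofR k R L (counit k R L v))
    simp [counit_apply]
  Δ_ηR r := by
    ext u v
    change act k R L (u * v) r = counit k R L (u * ofR k R L (act k R L v r))
    simp [counit_apply]
  coassoc φ := by
    ext u v w
    exact congrArg φ (mul_assoc u v w).symm
  Δ_one := dualComul_one
  Δ_mul := dualComul_mul
  continuous_Δ := continuous_dual₂_iff.2 fun u v => continuous_eval (u * v)

-- Taking `S ∘ μ(S ⊗ id)` for `μ(id ⊗ S)` is forced on `φ ⊗ ψ`, where `S(S(φ) ψ) = φ S(ψ)`. Its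
-- properties then follow from those of `S` and `μ(S ⊗ id)`.
variable (k R L) in
theorem dualData_isAntipode [TopologicalSpace R] [IsTopologicalRing R]
    (hcont : ∀ x : L, Continuous fun r : R => ⁅x, r⁆) :
    (dualData k R L).IsAntipode (antipode k R L) (antipode k R L ∘ₗ antipodeId k R L)
      (antipodeId k R L) where
  S_one := antipode_one
  S_mul := antipode_dualMul
  continuous_S := continuous_antipode hcont
  S_ηL := antipode_etaL
  S_ηR := antipode_etaR
  idS_tmul φ ψ := by
    change antipode k R L (antipodeId k R L (tmul k R L φ ψ)) = dualMul k R L φ (antipode k R L ψ)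
    rw [antipodeId_tmul, antipode_dualMul, antipode_antipode]
  Sid_tmul := antipodeId_tmul
  idS_mul F G := (congrArg _ (antipodeId_dualMul₂ F G)).trans (antipode_dualMul _ _)
  Sid_mul := antipodeId_dualMul₂
  continuous_idS := (continuous_antipode hcont).comp (continuous_antipodeId hcont)
  continuous_Sid := continuous_antipodeId hcont
  idS_Δ φ := (congrArg _ (antipodeId_dualComul φ)).trans (antipode_etaR _)
  Sid_Δ := antipodeId_dualComul

end LieRinehartDual

end

theorem mainTheorem5 (k R L : Type*) [CommRing k] [CommRing R] [Algebra k R] [LieRing L]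
    [LieAlgebra k L] [Module R L] [LieRingModule L R] [LieRinehartRing R L]
    [LieRinehartAlgebra k R L] [TopologicalSpace R] [IsTopologicalRing R]
    (hcont : ∀ x : L, Continuous fun r : R => ⁅x, r⁆) :
    (LieRinehartDual.dualData k R L).IsBialgebroid ∧
    ∃ (S : LieRinehartDual.Dual k R L →ₗ[k] LieRinehartDual.Dual k R L)
      (idS Sid : LieRinehartDual.Dual₂ k R L →ₗ[k] LieRinehartDual.Dual k R L),
      (LieRinehartDual.dualData k R L).IsAntipode S idS Sid ∧
      (∀ (F : LieRinehartDual.Dual₂ k R L) (u : LieRinehartDual.U k R L) (n : ℕ)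
        (a b : Fin n → LieRinehartDual.U k R L),
        LieRinehartDual.comul k R L u = ∑ i, a i ⊗ₜ[R] b i →
        Sid F u = ∑ i, S (LieRinehartDual.slice F (b i)) (a i)) ∧
      ∀ F : LieRinehartDual.Dual₂ k R L, idS F = S (Sid F) := by
  refine ⟨LieRinehartDual.dualData_isBialgebroid k R L hcont, LieRinehartDual.antipode k R L,
    LieRinehartDual.antipode k R L ∘ₗ LieRinehartDual.antipodeId k R L,
    LieRinehartDual.antipodeId k R L, LieRinehartDual.dualData_isAntipode k R L hcont, ?_,
    fun F => rfl⟩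
  intro F u n a b h
  -- `antipodeSlice F` is linear on `U ⊗ U`, so any representation of `Δ(u)` as a sum of pure
  -- tensors may be used.
  simp [LieRinehartDual.antipodeId_apply, h]
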